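/- Let $f$ be a transcendental (i.e. non-rational) meromorphic function in the complex plane $\mathbb C$. A point $a\in\mathbb C\cup\{\infty\}$ is an asymptotic value of $f$ if there is a curve $\gamma:[0,\infty)\to\mathbb C$ with $\gamma(t)\to\infty$ and $f(\gamma(t))\to a$ as $t\to\infty$. Suppose that $f$ belongs to the Eremenko–Lyubich class $\mathcal B$, i.e. the set of its finite critical values and finite asymptotic values is bounded, that the order $$\rho=\limsup_{r\to\infty}\frac{\log T(r,f)}{\log r}$$ is finite, where $T(r,f)$ is the Nevanlinna characteristic of $f$, and that $\infty$ is not an asymptotic value of $f$. Suppose also that there is an integer $M\ge 1$ such that all poles of $f$, except possibly finitely many, have multiplicity at most $M$. Let $I(f)$ be the set of all $z\in\mathbb C$ for which all iterates $f^n(z)$ are defined and finite and $f^n(z)\to\infty$ as $n\to\infty$; for $R>0$ let $I_R(f)$ be the set of all $z\in\mathbb C$ for which all iterates $f^n(z)$ are defined and finite and $\liminf_{n\to\infty}|f^n(z)|\ge R$. Denote by $\mathrm{HD}$ the Hausdorff dimension. Then $$\mathrm{HD}(I(f))\le\frac{2M\rho}{2+M\rho},$$ the limit $\lim_{R\to\infty}\mathrm{HD}(I_R(f))$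 exists, and $$\lim_{R\to\infty}\mathrm{HD}(I_R(f))\le\frac{2M\rho}{2+M\rho}.$$ -/

import Mathlib

open Filter Topology Set

namespace MeroDyn

/-! A function meromorphic in the plane is represented by `f : ℂ → ℂ` with
`MeromorphicNFOn f univ`: `f` is meromorphic, is analytic at every point that is not a pole, and
takes the conventional value `0` at its poles. Every meromorphic function has exactly one such
representative. The conventional value at the poles is never used as a value of the function. -/

/-- `z` is a pole of `f`. -/
def IsPole (f : ℂ → ℂ) (z : ℂ) : Prop := meromorphicOrderAt f z < 0

/-- The multiplicity of a pole (and `0` at points that are not poles). -/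
noncomputable def poleMultiplicity (f : ℂ → ℂ) (z : ℂ) : ℕ :=
  (-(meromorphicOrderAt f z).untop₀).toNat

open Classical in
/-- `f` as a map into the Riemann sphere, with the value `∞` at the poles. -/
noncomputable def toSphere (f : ℂ → ℂ) (z : ℂ) : OnePoint ℂ :=
  if IsPole f z then OnePoint.infty else (f z : OnePoint ℂ)

/-- `f` is transcendental, that is, not a rational function. -/
def IsTranscendental (f : ℂ → ℂ) : Prop :=
  ¬ ∃ p q : Polynomial ℂ, q ≠ 0 ∧ ∀ z : ℂ, q.eval z ≠ 0 → f z = p.eval z / q.eval z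

/-- `v` is a finite critical value of `f`. -/
def IsCriticalValue (f : ℂ → ℂ) (v : ℂ) : Prop :=
  ∃ z : ℂ, ¬ IsPole f z ∧ deriv f z = 0 ∧ f z = v

/-- The point `a` of the Riemann sphere is an asymptotic value of `f`: there is a curve
`γ : [0, ∞) → ℂ` tending to `∞` along which `f` tends to `a`. -/
def IsAsymptoticValue (f : ℂ → ℂ) (a : OnePoint ℂ) : Prop :=
  ∃ γ : ℝ → ℂ, ContinuousOn γ (Ici 0) ∧ Tendsto γ atTop (Bornology.cobounded ℂ) ∧
    Tendsto (fun t => toSphere f (γ t)) atTop (𝓝 a)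

/-- The set of finite singularities of the inverse function of `f`. -/
def singInverse (f : ℂ → ℂ) : Set ℂ :=
  {v | IsCriticalValue f v ∨ IsAsymptoticValue f (v : OnePoint ℂ)}

/-- The Eremenko-Lyubich class. -/
def ClassB (f : ℂ → ℂ) : Prop := Bornology.IsBounded (singInverse f)

/-- The order of growth: `limsup` of `log T(r, f) / log r`, with `T` the Nevanlinna
characteristic. -/
noncomputable def order (f : ℂ → ℂ) : EReal :=
  limsup (fun r : ℝ =>
    ((Real.log (ValueDistribution.characteristic f ⊤ r) / Real.log r : ℝ) : EReal)) atTop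

/-- All iterates `f^n(z)` are defined (and finite): no point of the orbit is a pole. -/
def OrbitDefined (f : ℂ → ℂ) (z : ℂ) : Prop := ∀ n : ℕ, ¬ IsPole f (f^[n] z)

/-- The set `I(f)` of points whose iterates are all defined and tend to `∞`. -/
def escapingSet (f : ℂ → ℂ) : Set ℂ :=
  {z | OrbitDefined f z ∧ Tendsto (fun n : ℕ => f^[n] z) atTop (Bornology.cobounded ℂ)}

/-- The set `I_R(f)` of points whose iterates are all defined and satisfy
`liminf |f^n(z)| ≥ R` (the `liminf` may be infinite). -/
def escapingSetAbove (f : ℂ → ℂ) (R : ℝ) : Set ℂ :=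
  {z | OrbitDefined f z ∧ ENNReal.ofReal R ≤ liminf (fun n : ℕ => ‖f^[n] z‖ₑ) atTop}

end MeroDyn

/-! ### Poles, the sphere-valued map and limits of curves. -/

namespace MeroDyn

/-! Choose `R ≥ 1` bounding `|f 0|` and all finite singular values. Curves in `{|w| > R}` lift
through `f`: a lift could break down only at a critical point, or by running to `∞` over a finite
value, which would then be an asymptotic value. Since `∞` is not asymptotic, a lift of a radial ray
to `∞` ends at a pole. Hence `{|f| > R}` together with the poles splits into discs ("tracts"), one
for each pole `a`; if `a` has multiplicity `m`, its tract has a conformal coordinate `G_a` with `f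
(G_a u) = u^(-m)` (`exists_isTractMap`, `exists_mem_tract`).

In these coordinates an inverse branch from the tract of `b` to that of `a` is `v ↦ G_b(v)^(-1/m)`.
For large poles its derivative is at most a constant times `|b|^(-1/M) β_b`, where `β_b` bounds
`|G_b'/G_b|` on a smaller disc. Two facts control these numbers. First, `β_b²` is at most a constant
times the area of the tract in the metric `|dz|/|z|`, and tracts are disjoint, so `∑ β_b² |b|^(-ε)`
over large poles converges for every `ε > 0` (`exists_deriv_bounds`). Secondly, the poles have
exponent of convergence at most `ρ` (`tsum_poles_rpow_ne_top`). A weighted mean inequality with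
weights `t/2` and `1 - t/2` then makes `∑ (|b|^(-1/M) β_b)^t` finite once `t/M > ρ (1 - t/2)`, which
is `t > 2Mρ/(2 + Mρ)` (`tsum_contraction_ne_top`).

Keeping only poles of large modulus makes the total `t`-sum of the branches at most `1/2`, so
iterated covers show that the points whose orbit stays far out form a set of dimension at most `t`
(`dimH_le_of_contractions`, `exists_dimH_stayingSet_le`). Orbits from `I_R(f)` with `R` large
eventually enter that set, and preimages under `f` do not raise dimension. Since `I_R(f)` decreases
with `R` and contains `I(f)`, both claims follow. -/

theorem meromorphicAt_of_nf {f : ℂ → ℂ} (hf : MeromorphicNFOn f univ) (z : ℂ) : MeromorphicAt f z :=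
  (hf (mem_univ z)).meromorphicAt

theorem analyticAt_of_not_isPole {f : ℂ → ℂ} (hf : MeromorphicNFOn f univ) {z : ℂ}
    (hz : ¬ IsPole f z) : AnalyticAt ℂ f z :=
  (hf (mem_univ z)).meromorphicOrderAt_nonneg_iff_analyticAt.1 (not_lt.1 hz)

theorem not_isPole_of_analyticAt {f : ℂ → ℂ} {z : ℂ} (h : AnalyticAt ℂ f z) : ¬ IsPole f z :=
  not_lt.2 h.meromorphicOrderAt_nonneg

theorem isOpen_setOf_not_isPole {f : ℂ → ℂ} (hf : MeromorphicNFOn f univ) :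
    IsOpen {z | ¬ IsPole f z} := by
  have : {z | ¬ IsPole f z} = {z | AnalyticAt ℂ f z} := by
    ext z; exact ⟨analyticAt_of_not_isPole hf, not_isPole_of_analyticAt⟩
  rw [this]; exact isOpen_analyticAt ℂ f

theorem tendsto_cobounded_of_isPole {f : ℂ → ℂ} {a : ℂ} (ha : IsPole f a) :
    Tendsto f (𝓝[≠] a) (Bornology.cobounded ℂ) :=
  tendsto_cobounded_of_meromorphicOrderAt_neg ha

theorem eventually_not_isPole {f : ℂ → ℂ} (hf : MeromorphicNFOn f univ) (z : ℂ) :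
    ∀ᶠ z' in 𝓝[≠] z, ¬ IsPole f z' := by
  filter_upwards [(meromorphicAt_of_nf hf z).eventually_analyticAt] with z' h
  exact not_isPole_of_analyticAt h

theorem toSphere_of_isPole {f : ℂ → ℂ} {z : ℂ} (h : IsPole f z) : toSphere f z = OnePoint.infty :=
  if_pos h

theorem toSphere_of_not_isPole {f : ℂ → ℂ} {z : ℂ} (h : ¬ IsPole f z) : toSphere f z = (f z : ℂ) :=
  if_neg h

theorem toSphere_eq_infty_iff {f : ℂ → ℂ} {z : ℂ} : toSphere f z = OnePoint.infty ↔ IsPole f z := by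
  by_cases h : IsPole f z
  · simp [toSphere_of_isPole h, h]
  · simp [toSphere_of_not_isPole h, h]

theorem toSphere_eq_coe_iff {f : ℂ → ℂ} {z w : ℂ} :
    toSphere f z = (w : OnePoint ℂ) ↔ ¬ IsPole f z ∧ f z = w := by
  by_cases h : IsPole f z
  · simp [toSphere_of_isPole h, h]
  · simp [toSphere_of_not_isPole h, h]

theorem tendsto_coe_infty_cobounded :
    Tendsto ((↑) : ℂ → OnePoint ℂ) (Bornology.cobounded ℂ) (𝓝 OnePoint.infty) := by
  rw [Metric.cobounded_eq_cocompact, ← coclosedCompact_eq_cocompact]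
  exact OnePoint.tendsto_coe_infty

theorem continuous_toSphere {f : ℂ → ℂ} (hf : MeromorphicNFOn f univ) : Continuous (toSphere f) := by
  rw [continuous_iff_continuousAt]
  intro z
  by_cases h : IsPole f z
  · have : Tendsto (toSphere f) (𝓝[≠] z) (𝓝 (toSphere f z)) := by
      rw [toSphere_of_isPole h]
      refine (tendsto_coe_infty_cobounded.comp (tendsto_cobounded_of_isPole h)).congr' ?_
      filter_upwards [eventually_not_isPole hf z] with z' hz'
      simp [toSphere_of_not_isPole hz']
    exact continuousWithinAt_compl_self.1 this
  · have h1 : ContinuousAt (fun z => (f z : OnePoint ℂ)) z :=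
      OnePoint.continuous_coe.continuousAt.comp (analyticAt_of_not_isPole hf h).continuousAt
    refine h1.congr ?_
    filter_upwards [(isOpen_setOf_not_isPole hf).mem_nhds h] with z' hz'
    exact (toSphere_of_not_isPole hz').symm

/-- A meromorphic function that is not a constant takes no value on a set with an accumulation
point. -/
theorem eventually_toSphere_ne {f : ℂ → ℂ} (hf : MeromorphicNFOn f univ)
    (hnc : ∀ c : ℂ, ∃ z, f z ≠ c) (w : OnePoint ℂ) (z : ℂ) :
    ∀ᶠ z' in 𝓝[≠] z, toSphere f z' ≠ w := by
  induction w using OnePoint.rec with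
  | infty =>
    filter_upwards [eventually_not_isPole hf z] with z' hz' h
    exact hz' (toSphere_eq_infty_iff.1 h)
  | coe c =>
    have hm : MeromorphicOn (fun z => f z - c) univ := fun z _ =>
      (meromorphicAt_of_nf hf z).sub (MeromorphicAt.const c z)
    by_cases ht : meromorphicOrderAt (fun z => f z - c) z = ⊤
    · exfalso
      obtain ⟨z₁, hz₁⟩ := hnc c
      -- Identity theorem: infinite order at one point propagates over the connected plane. At `z₁`
      -- the normal form then turns equality on a punctured neighbourhood into equality at `z₁`
      -- itself.
      have h1 : meromorphicOrderAt (fun z => f z - c) z₁ = ⊤ := by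
        by_contra hne
        have := (hm.exists_meromorphicOrderAt_ne_top_iff_forall isConnected_univ).1
          ⟨⟨z₁, mem_univ _⟩, hne⟩ ⟨z, mem_univ _⟩
        exact this ht
      rw [meromorphicOrderAt_eq_top_iff] at h1
      have h2 : f =ᶠ[𝓝[≠] z₁] fun _ => c := by
        filter_upwards [h1] with x hx using sub_eq_zero.1 hx
      have h3 := ((hf (mem_univ z₁)).eventuallyEq_nhdsNE_iff_eventuallyEq_nhds
        analyticAt_const.meromorphicNFAt).1 h2
      exact hz₁ h3.eq_of_nhds
    · have := (meromorphicOrderAt_ne_top_iff_eventually_ne_zero (hm z (mem_univ _))).1 ht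
      filter_upwards [this] with z' h h'
      rw [toSphere_eq_coe_iff] at h'
      exact h (sub_eq_zero.2 h'.2)

/-- A curve along which a continuous map with discrete fibres converges either tends to infinity
or converges. -/
theorem tendsto_cobounded_or_exists_tendsto {X : Type*} [TopologicalSpace X] [T2Space X]
    {F : ℂ → X} (hF : Continuous F) {w : X} (hd : ∀ z, ∀ᶠ z' in 𝓝[≠] z, F z' ≠ w) {g : ℝ → ℂ}
    (hg : ContinuousOn g (Ici 0)) (hw : Tendsto (fun t => F (g t)) atTop (𝓝 w)) :
    Tendsto g atTop (Bornology.cobounded ℂ) ∨ ∃ z, F z = w ∧ Tendsto g atTop (𝓝 z) := by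
  by_cases h : Tendsto g atTop (Bornology.cobounded ℂ)
  · exact Or.inl h
  right
  have hne : (atTop : Filter ℝ).NeBot := inferInstance
  obtain ⟨r, hr⟩ : ∃ r : ℝ, ∃ᶠ t in atTop, g t ∈ Metric.closedBall (0 : ℂ) r := by
    by_contra hcon
    push Not at hcon
    apply h
    rw [← tendsto_norm_atTop_iff_cobounded, tendsto_atTop]
    intro b
    filter_upwards [hcon b] with t ht
    simp at ht; exact ht.le
  obtain ⟨z, -, hz⟩ := (isCompact_closedBall (0 : ℂ) r).exists_mapClusterPt_of_frequently hr
  have hFz : F z = w := by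
    have h1 : MapClusterPt (F z) atTop (fun t => F (g t)) := hz.continuousAt_comp hF.continuousAt
    by_contra hne'
    have := disjoint_nhds_nhds.2 hne'
    have h2 : MapClusterPt (F z) atTop (fun t => F (g t)) := h1
    rw [MapClusterPt, ClusterPt] at h2
    exact h2.ne (disjoint_iff.1 (this.mono_right hw))
  refine ⟨z, hFz, ?_⟩
  obtain ⟨δ, hδ, hball⟩ := Metric.eventually_nhds_iff.1 (eventually_nhdsWithin_iff.1 (hd z))
  rw [Metric.tendsto_atTop']
  intro ε hε
  -- The circle of radius `η` about the cluster point `z` misses the fibre of `w`, so its image is a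
  -- compact set avoiding `w`. Once `F (g t)` has left this image for good, `g` can no longer cross
  -- the circle.
  set η := min (ε/2) (δ/2) with hη
  have hη0 : 0 < η := by positivity
  have hcpt : IsCompact (F '' Metric.sphere z η) := (isCompact_sphere z η).image hF
  have hnot : w ∉ F '' Metric.sphere z η := by
    rintro ⟨y, hy, rfl⟩
    refine hball (y := y) ?_ ?_ rfl
    · rw [Metric.mem_sphere.1 hy]; exact lt_of_le_of_lt (min_le_right _ _) (by linarith)
    · rintro rfl; simp at hy; exact hη0.ne hy
  obtain ⟨T, hT⟩ := eventually_atTop.1 (hw.eventually (hcpt.isClosed.isOpen_compl.mem_nhds hnot))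
  obtain ⟨t₀, ht₀, hin⟩ := frequently_atTop.1
    (hz.frequently (Metric.ball_mem_nhds z hη0)) (max T 0)
  refine ⟨t₀, fun t ht => ?_⟩
  by_contra hfar
  have hcont : ContinuousOn (fun s => dist (g s) z) (Icc t₀ t) :=
    (show Continuous fun x : ℂ => dist x z by fun_prop).comp_continuousOn
      (hg.mono fun s (hs : s ∈ Icc t₀ t) =>
        mem_Ici.2 (le_trans (le_trans (le_max_right _ _) ht₀) hs.1))
  have hmem : η ∈ Icc (dist (g t₀) z) (dist (g t) z) :=
    ⟨(Metric.mem_ball.1 hin).le, le_trans ((min_le_left _ _).trans (by linarith)) (not_lt.1 hfar)⟩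
  obtain ⟨s, hs, hs'⟩ := intermediate_value_Icc ht.le hcont hmem
  exact hT s (le_trans (le_trans (le_max_left _ _) ht₀) hs.1) ⟨g s, hs', rfl⟩

end MeroDyn

/-! ### Lifting curves over `{|w| > R}`. -/

namespace MeroDyn

/-- The finite singularities of the inverse of `f`, and `f 0`, have modulus at most `R`, and `∞`
is not an asymptotic value. -/
structure RegularAbove (f : ℂ → ℂ) (R : ℝ) : Prop where
  nf : MeromorphicNFOn f univ
  nonconst : ∀ c : ℂ, ∃ z, f z ≠ c
  one_le : 1 ≤ R
  norm_zero_le : ‖f 0‖ ≤ R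
  sing : ∀ v ∈ singInverse f, ‖v‖ ≤ R
  infty : ¬ IsAsymptoticValue f OnePoint.infty

/-- The points where `f` is finite and larger than `R` in modulus. -/
def highSet (f : ℂ → ℂ) (R : ℝ) : Set ℂ := {z | ¬ IsPole f z ∧ R < ‖f z‖}

variable {f : ℂ → ℂ} {R : ℝ}

namespace RegularAbove

theorem isOpen_highSet (h : RegularAbove f R) : IsOpen (highSet f R) := by
  have hc : ContinuousOn (fun z => ‖f z‖) {z | ¬ IsPole f z} := fun z hz =>
    (analyticAt_of_not_isPole h.nf hz).continuousAt.norm.continuousWithinAt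
  exact hc.isOpen_inter_preimage (isOpen_setOf_not_isPole h.nf) isOpen_Ioi

theorem analyticAt (h : RegularAbove f R) {z : ℂ} (hz : z ∈ highSet f R) : AnalyticAt ℂ f z :=
  analyticAt_of_not_isPole h.nf hz.1

theorem deriv_ne_zero (h : RegularAbove f R) {z : ℂ} (hz : z ∈ highSet f R) : deriv f z ≠ 0 := by
  intro h0
  exact absurd (h.sing (f z) (Or.inl ⟨z, hz.1, h0, rfl⟩)) (not_le.2 hz.2)

theorem isLocalHomeomorphOn (h : RegularAbove f R) : IsLocalHomeomorphOn f (highSet f R) := by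
  refine IsLocalHomeomorphOn.mk f _ fun z hz => ?_
  have hs : HasStrictDerivAt f (deriv f z) z := (h.analyticAt hz).hasStrictDerivAt
  have hs' := hs.hasStrictFDerivAt_equiv (h.deriv_ne_zero hz)
  exact ⟨hs'.toOpenPartialHomeomorph f, hs'.mem_toOpenPartialHomeomorph_source,
    fun x _ => by rw [HasStrictFDerivAt.toOpenPartialHomeomorph_coe]⟩

theorem isLocalHomeomorph (h : RegularAbove f R) :
    IsLocalHomeomorph (fun z : highSet f R => f z) := by
  rw [isLocalHomeomorph_iff_isLocalHomeomorphOn_univ]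
  exact h.isLocalHomeomorphOn.comp
    h.isOpen_highSet.isOpenEmbedding_subtypeVal.isLocalHomeomorph.isLocalHomeomorphOn
    fun z _ => z.2

/-- Unique lifting through a local homeomorphism with Hausdorff domain. Every later identification
of two curves or two coordinates rests on it. -/
theorem eqOn_of_lifts (h : RegularAbove f R) {s : Set ℝ} (hs : IsPreconnected s) {g₁ g₂ : ℝ → ℂ}
    (h₁ : ContinuousOn g₁ s) (h₂ : ContinuousOn g₂ s) (hm₁ : MapsTo g₁ s (highSet f R))
    (hm₂ : MapsTo g₂ s (highSet f R)) (he : ∀ t ∈ s, f (g₁ t) = f (g₂ t)) {t₀ : ℝ} (ht₀ : t₀ ∈ s)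
    (heq : g₁ t₀ = g₂ t₀) : EqOn g₁ g₂ s := by
  have := isPreconnected_iff_preconnectedSpace.1 hs
  let G₁ : s → highSet f R := fun t => ⟨g₁ t, hm₁ t.2⟩
  let G₂ : s → highSet f R := fun t => ⟨g₂ t, hm₂ t.2⟩
  have c₁ : Continuous G₁ := (continuousOn_iff_continuous_domRestrict.1 h₁).subtype_mk _
  have c₂ : Continuous G₂ := (continuousOn_iff_continuous_domRestrict.1 h₂).subtype_mk _
  have := (T2Space.isSeparatedMap (fun z : highSet f R => f z)).eq_of_comp_eq
    h.isLocalHomeomorph.isLocallyInjective c₁ c₂ (funext fun t => he t t.2) ⟨t₀, ht₀⟩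
    (Subtype.ext heq)
  intro t ht
  exact congrArg Subtype.val (congrFun this ⟨t, ht⟩)

/-- A curve in the domain whose image converges to a finite value of modulus larger than `R`
converges to a point of `highSet f R`. -/
theorem exists_tendsto (h : RegularAbove f R) {w : ℂ} (hw : R < ‖w‖) {g : ℝ → ℂ}
    (hg : ContinuousOn g (Ici 0)) (hm : MapsTo g (Ici 0) (highSet f R))
    (hlim : Tendsto (fun t => f (g t)) atTop (𝓝 w)) :
    ∃ z ∈ highSet f R, f z = w ∧ Tendsto g atTop (𝓝 z) := by
  have h1 : Tendsto (fun t => toSphere f (g t)) atTop (𝓝 (w : OnePoint ℂ)) := by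
    refine ((OnePoint.continuous_coe.tendsto w).comp hlim).congr' ?_
    filter_upwards [eventually_ge_atTop 0] with t ht
    exact (toSphere_of_not_isPole (hm ht).1).symm
  rcases tendsto_cobounded_or_exists_tendsto (continuous_toSphere h.nf)
    (eventually_toSphere_ne h.nf h.nonconst _) hg h1 with h2 | ⟨z, hz, h2⟩
  -- Running off to `∞` would make `w` an asymptotic value of modulus larger than `R`.
  · exact absurd (h.sing w (Or.inr ⟨g, hg, h2, h1⟩)) (not_le.2 hw)
  · rw [toSphere_eq_coe_iff] at hz
    exact ⟨z, ⟨hz.1, hz.2 ▸ hw⟩, hz.2, h2⟩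

/-- A curve in the domain whose image tends to `∞` converges to a pole. -/
theorem exists_tendsto_pole (h : RegularAbove f R) {g : ℝ → ℂ}
    (hg : ContinuousOn g (Ici 0)) (hm : MapsTo g (Ici 0) (highSet f R))
    (hlim : Tendsto (fun t => f (g t)) atTop (Bornology.cobounded ℂ)) :
    ∃ a, IsPole f a ∧ Tendsto g atTop (𝓝 a) := by
  have h1 : Tendsto (fun t => toSphere f (g t)) atTop (𝓝 OnePoint.infty) := by
    refine (tendsto_coe_infty_cobounded.comp hlim).congr' ?_
    filter_upwards [eventually_ge_atTop 0] with t ht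
    exact (toSphere_of_not_isPole (hm ht).1).symm
  rcases tendsto_cobounded_or_exists_tendsto (continuous_toSphere h.nf)
    (eventually_toSphere_ne h.nf h.nonconst _) hg h1 with h2 | ⟨z, hz, h2⟩
  · exact absurd ⟨g, hg, h2, h1⟩ h.infty
  · exact ⟨z, toSphere_eq_infty_iff.1 hz, h2⟩

/-- `g` lifts the curve `γ` on `[0, T]`, starting at `e`. -/
def IsLiftUpTo (f : ℂ → ℂ) (R : ℝ) (γ : ℝ → ℂ) (e : ℂ) (T : ℝ) (g : ℝ → ℂ) : Prop :=
  ContinuousOn g (Icc 0 T) ∧ MapsTo g (Icc 0 T) (highSet f R) ∧ (∀ t ∈ Icc 0 T, f (g t) = γ t) ∧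
    g 0 = e

theorem IsLiftUpTo.mono {γ g : ℝ → ℂ} {e : ℂ} {T S : ℝ} (h : IsLiftUpTo f R γ e T g) (hS : S ≤ T) :
    IsLiftUpTo f R γ e S g :=
  have hsub : Icc 0 S ⊆ Icc 0 T := Icc_subset_Icc_right hS
  ⟨h.1.mono hsub, h.2.1.mono_left hsub, fun t ht => h.2.2.1 t (hsub ht), h.2.2.2⟩

theorem IsLiftUpTo.eqOn (hR : RegularAbove f R) {γ g g' : ℝ → ℂ} {e : ℂ} {T : ℝ} (hT : 0 ≤ T)
    (h : IsLiftUpTo f R γ e T g) (h' : IsLiftUpTo f R γ e T g') : EqOn g g' (Icc 0 T) :=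
  hR.eqOn_of_lifts isPreconnected_Icc h.1 h'.1 h.2.1 h'.2.1
    (fun t ht => (h.2.2.1 t ht).trans (h'.2.2.1 t ht).symm) (left_mem_Icc.2 hT)
    (h.2.2.2.trans h'.2.2.2.symm)

/-- Openness half of the continuation argument: continue by the local inverse of `f` at the endpoint
of the lift. -/
theorem IsLiftUpTo.extend (hR : RegularAbove f R) {γ g : ℝ → ℂ} {e : ℂ} {T : ℝ} (hT : 0 ≤ T)
    (hγ : ContinuousOn γ (Ici 0)) (h : IsLiftUpTo f R γ e T g) :
    ∃ η > 0, ∃ g', IsLiftUpTo f R γ e (T + η) g' := by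
  have hTm : T ∈ Icc 0 T := right_mem_Icc.2 hT
  obtain ⟨p, hp, hpf⟩ := hR.isLocalHomeomorph ⟨g T, h.2.1 hTm⟩
  have hpf' : ∀ x : highSet f R, p x = f x := fun x => (congrFun hpf x).symm
  have htar : γ T ∈ p.target := by
    have := p.map_source hp
    rwa [hpf', h.2.2.1 T hTm] at this
  have hnear : ∀ᶠ t in 𝓝[Ici 0] T, γ t ∈ p.target :=
    (hγ T hT).eventually (p.open_target.mem_nhds htar)
  obtain ⟨δ, hδ, hδ'⟩ := Metric.mem_nhdsWithin_iff.1 hnear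
  have hin : ∀ t ∈ Icc T (T + δ / 2), γ t ∈ p.target := fun t ht => by
    refine hδ' ⟨?_, hT.trans ht.1⟩
    rw [Metric.mem_ball, Real.dist_eq, abs_of_nonneg (by linarith [ht.1])]
    linarith [ht.2]
  refine ⟨δ / 2, by positivity, fun t => if t ≤ T then g t else (p.symm (γ t) : ℂ), ?_, ?_, ?_, ?_⟩
  · have hbase : (p.symm (γ T) : ℂ) = g T := by
      have h1 : γ T = p ⟨g T, h.2.1 hTm⟩ := by rw [hpf']; exact (h.2.2.1 T hTm).symm
      rw [h1, p.left_inv hp]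
    have hc2 : ContinuousOn (fun t => (p.symm (γ t) : ℂ)) (Icc T (T + δ / 2)) :=
      continuous_subtype_val.comp_continuousOn
        (p.continuousOn_symm.comp (hγ.mono fun t ht => hT.trans ht.1) hin)
    have hunion : Icc 0 (T + δ / 2) = Icc 0 T ∪ Icc T (T + δ / 2) :=
      (Icc_union_Icc_eq_Icc hT (by linarith)).symm
    rw [hunion]
    refine ContinuousOn.union_of_isClosed ?_ ?_ isClosed_Icc isClosed_Icc
    · exact h.1.congr fun t ht => if_pos ht.2
    · refine hc2.congr fun t ht => ?_
      rcases ht.1.eq_or_lt with rfl | hlt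
      · simp [hbase]
      · exact if_neg (not_le.2 hlt)
  · intro t ht
    by_cases htT : t ≤ T
    · simpa [htT] using h.2.1 ⟨ht.1, htT⟩
    · simp [htT]
  · intro t ht
    by_cases htT : t ≤ T
    · simpa [htT] using h.2.2.1 t ⟨ht.1, htT⟩
    · have : p (p.symm (γ t)) = γ t := p.right_inv (hin t ⟨(not_le.1 htT).le, ht.2⟩)
      rw [hpf'] at this
      simpa [htT] using this
  · simpa [hT] using h.2.2.2

/-- Closedness half of the continuation argument: by uniqueness the partial lifts glue to a lift on
`[0, s)`, and this has an endpoint because no value of modulus above `R` is asymptotic. -/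
theorem IsLiftUpTo.exists_limit (hR : RegularAbove f R) {γ : ℝ → ℂ} {e : ℂ} {s : ℝ} (hs : 0 < s)
    (hγ : ContinuousOn γ (Ici 0)) (hγR : ∀ t, 0 ≤ t → R < ‖γ t‖)
    (h : ∀ T ∈ Ico 0 s, ∃ g, IsLiftUpTo f R γ e T g) : ∃ g, IsLiftUpTo f R γ e s g := by
  choose! G hG using h
  set g : ℝ → ℂ := fun t => G t t with hgdef
  have hagree : ∀ T ∈ Ico 0 s, EqOn g (G T) (Icc 0 T) := fun T hT t ht =>
    IsLiftUpTo.eqOn hR ht.1 (hG t ⟨ht.1, ht.2.trans_lt hT.2⟩) ((hG T hT).mono ht.2)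
      (right_mem_Icc.2 ht.1)
  have hlift : ∀ T ∈ Ico 0 s, IsLiftUpTo f R γ e T g := fun T hT => by
    have := hG T hT
    refine ⟨this.1.congr (hagree T hT), fun t ht => ?_, fun t ht => ?_, ?_⟩
    · rw [hagree T hT ht]; exact this.2.1 ht
    · rw [hagree T hT ht]; exact this.2.2.1 t ht
    · rw [hagree T hT (left_mem_Icc.2 hT.1)]; exact this.2.2.2
  have hcont : ContinuousOn g (Ico 0 s) := fun t ht => by
    have hm : (t + s) / 2 ∈ Ico 0 s := ⟨by linarith [ht.1], by linarith [ht.2]⟩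
    have h1 := (hlift _ hm).1 t ⟨ht.1, by linarith [ht.2]⟩
    refine h1.mono_of_mem_nhdsWithin ?_
    have : Ico 0 s ∩ Iio ((t + s) / 2) ⊆ Icc 0 ((t + s) / 2) := fun x hx => ⟨hx.1.1, hx.2.le⟩
    exact mem_of_superset (inter_mem_nhdsWithin _ (Iio_mem_nhds (by linarith [ht.2]))) this
  have hself : ∀ t ∈ Ico 0 s, t ∈ Icc 0 t := fun t ht => right_mem_Icc.2 ht.1
  -- Reparametrise `[0, s)` by `[0, ∞)`
  set φ : ℝ → ℝ := fun τ => s * (1 - Real.exp (-τ)) with hφ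
  have hφm : MapsTo φ (Ici 0) (Ico 0 s) := fun τ hτ => by
    have h1 : Real.exp (-τ) ≤ 1 := Real.exp_le_one_iff.2 (by simpa using hτ)
    have h2 := Real.exp_pos (-τ)
    exact ⟨mul_nonneg hs.le (by linarith), by simp only [hφ]; nlinarith⟩
  have hφc : Continuous φ := by fun_prop
  have hφl : Tendsto φ atTop (𝓝 s) := by
    have : Tendsto (fun τ : ℝ => s * (1 - Real.exp (-τ))) atTop (𝓝 (s * (1 - 0))) :=
      (Real.tendsto_exp_neg_atTop_nhds_zero.const_sub 1).const_mul s
    simpa using this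
  have hφw : Tendsto φ atTop (𝓝[Ici 0] s) := tendsto_nhdsWithin_iff.2 ⟨hφl, by
    filter_upwards [eventually_ge_atTop 0] with τ hτ using (hφm hτ).1⟩
  have hγl : Tendsto (fun τ => f (g (φ τ))) atTop (𝓝 (γ s)) := by
    refine ((hγ s hs.le).tendsto.comp hφw).congr' ?_
    filter_upwards [eventually_ge_atTop 0] with τ hτ
    exact ((hlift _ (hφm hτ)).2.2.1 _ (hself _ (hφm hτ))).symm
  obtain ⟨z, hz, hfz, hlim⟩ := hR.exists_tendsto (hγR s hs.le)
    (g := fun τ => g (φ τ)) (hcont.comp hφc.continuousOn hφm)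
    (fun τ hτ => (hlift _ (hφm hτ)).2.1 (hself _ (hφm hτ))) hγl
  have hgl : Tendsto g (𝓝[<] s) (𝓝 z) := by
    -- `ψ` inverts `φ` on `[0, s)`; it carries the limit as `τ → ∞` back to the limit as `t`
    -- increases to `s`.
    set ψ : ℝ → ℝ := fun t => -Real.log (1 - t / s) with hψ
    have hψl : Tendsto ψ (𝓝[<] s) atTop := by
      have h1 : Tendsto (fun t : ℝ => 1 - t / s) (𝓝[<] s) (𝓝[>] 0) := by
        refine tendsto_nhdsWithin_iff.2 ⟨?_, ?_⟩
        · have : Continuous fun t : ℝ => 1 - t / s := by fun_prop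
          have h2 := (this.tendsto s).mono_left (nhdsWithin_le_nhds (s := Iio s))
          simpa [hs.ne'] using h2
        · filter_upwards [self_mem_nhdsWithin] with t ht
          have : t / s < 1 := (div_lt_one hs).2 ht
          exact sub_pos.2 this
      exact tendsto_neg_atBot_atTop.comp (Real.tendsto_log_nhdsGT_zero.comp h1)
    refine (hlim.comp hψl).congr' ?_
    filter_upwards [self_mem_nhdsWithin] with t ht
    have h1 : 0 < 1 - t / s := sub_pos.2 ((div_lt_one hs).2 ht)
    have : φ (ψ t) = t := by
      simp only [hφ, hψ, neg_neg, Real.exp_log h1]; field_simp; ring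
    simp [this]
  refine ⟨fun t => if t < s then g t else z, ?_, ?_, ?_, ?_⟩
  · intro t ht
    rcases ht.2.lt_or_eq with hlt | rfl
    · have h1 := hcont t ⟨ht.1, hlt⟩
      have h2 : ContinuousWithinAt (fun t => if t < s then g t else z) (Ico 0 s) t :=
        h1.congr (fun x hx => if_pos hx.2) (if_pos hlt)
      refine h2.mono_of_mem_nhdsWithin ?_
      have : Icc 0 s ∩ Iio s ⊆ Ico 0 s := fun x hx => ⟨hx.1.1, hx.2⟩
      exact mem_of_superset (inter_mem_nhdsWithin _ (Iio_mem_nhds hlt)) this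
    · have h2 : ContinuousWithinAt (fun x => if x < t then g x else z) (Iio t) t := by
        have : Tendsto (fun x => if x < t then g x else z) (𝓝[<] t) (𝓝 z) := by
          refine hgl.congr' ?_
          filter_upwards [self_mem_nhdsWithin] with x hx
          rw [if_pos (show x < t from hx)]
        simpa [ContinuousWithinAt] using this
      have h3 := continuousWithinAt_insert_self.2 h2
      exact h3.mono fun x hx => by
        rcases hx.2.lt_or_eq with h | h
        · exact Or.inr h
        · exact Or.inl h
  · intro t ht
    rcases ht.2.lt_or_eq with hlt | rfl
    · simpa [hlt] using (hlift t ⟨ht.1, hlt⟩).2.1 (hself t ⟨ht.1, hlt⟩)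
    · simpa using hz
  · intro t ht
    rcases ht.2.lt_or_eq with hlt | rfl
    · simpa [hlt] using (hlift t ⟨ht.1, hlt⟩).2.2.1 t (hself t ⟨ht.1, hlt⟩)
    · simpa using hfz
  · simpa [hs] using (hlift 0 ⟨le_rfl, hs⟩).2.2.2

/-- Curves in `{|w| > R}` lift. -/
theorem exists_lift (hR : RegularAbove f R) {γ : ℝ → ℂ} (hγ : ContinuousOn γ (Ici 0))
    (hγR : ∀ t, 0 ≤ t → R < ‖γ t‖) {e : ℂ} (he : e ∈ highSet f R) (hfe : f e = γ 0) :
    ∃ g : ℝ → ℂ, ContinuousOn g (Ici 0) ∧ MapsTo g (Ici 0) (highSet f R) ∧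
      (∀ t, 0 ≤ t → f (g t) = γ t) ∧ g 0 = e := by
  have hall : ∀ T, 0 ≤ T → ∃ g, IsLiftUpTo f R γ e T g := by
    by_contra hcon
    push Not at hcon
    obtain ⟨T₁, hT₁, hbad⟩ := hcon
    -- The supremum of the liftable lengths is attained by `exists_limit` and exceeded by `extend`.
    set S : Set ℝ := {T | 0 ≤ T ∧ ∃ g, IsLiftUpTo f R γ e T g} with hS
    have h0 : (0 : ℝ) ∈ S := ⟨le_rfl, fun _ => e, continuousOn_const, fun _ _ => he, by
      intro t ht; rw [Icc_self] at ht; rw [mem_singleton_iff.1 ht]; exact hfe, rfl⟩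
    have hbdd : BddAbove S := ⟨T₁, fun T hT => by
      by_contra hlt
      obtain ⟨g, hg⟩ := hT.2
      exact hbad g (hg.mono (not_le.1 hlt).le)⟩
    have hs0 : 0 ≤ sSup S := le_csSup hbdd h0
    have hs : sSup S ∈ S := by
      rcases hs0.eq_or_lt with h | h
      · rwa [← h]
      · refine ⟨hs0, IsLiftUpTo.exists_limit hR h hγ hγR fun T hT => ?_⟩
        obtain ⟨T', hT', hlt⟩ := exists_lt_of_lt_csSup ⟨0, h0⟩ hT.2
        obtain ⟨g, hg⟩ := hT'.2
        exact ⟨g, hg.mono hlt.le⟩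
    obtain ⟨g, hg⟩ := hs.2
    obtain ⟨η, hη, g', hg'⟩ := hg.extend hR hs0 hγ
    have : sSup S + η ∈ S := ⟨by linarith, g', hg'⟩
    linarith [le_csSup hbdd this]
  choose! G hG using hall
  have hagree : ∀ T, 0 ≤ T → EqOn (fun t => G t t) (G T) (Icc 0 T) := fun T hT t ht =>
    IsLiftUpTo.eqOn hR ht.1 (hG t ht.1) ((hG T hT).mono ht.2) (right_mem_Icc.2 ht.1)
  refine ⟨fun t => G t t, fun t ht => ?_, fun t ht => (hG t ht).2.1 (right_mem_Icc.2 ht),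
    fun t ht => (hG t ht).2.2.1 t (right_mem_Icc.2 ht), (hG 0 le_rfl).2.2.2⟩
  have ht' : (0 : ℝ) ≤ t + 1 := by linarith [mem_Ici.1 ht]
  have h1 := ((hG (t + 1) ht').1.congr (hagree _ ht')) t ⟨ht, by linarith⟩
  refine h1.mono_of_mem_nhdsWithin ?_
  have : Ici 0 ∩ Iio (t + 1) ⊆ Icc 0 (t + 1) := fun x hx => ⟨hx.1, hx.2.le⟩
  exact mem_of_superset (inter_mem_nhdsWithin _ (Iio_mem_nhds (by linarith))) this

end RegularAbove
end MeroDyn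

/-! ### Conformal coordinates on the tracts. -/

namespace MeroDyn

theorem exists_pole_factorization {f : ℂ → ℂ} {a : ℂ} (hf : MeromorphicNFOn f univ)
    (ha : IsPole f a) : 0 < poleMultiplicity f a ∧ ∃ g : ℂ → ℂ, AnalyticAt ℂ g a ∧ g a ≠ 0 ∧
      ∀ᶠ z in 𝓝[≠] a, f z = ((z - a) ^ poleMultiplicity f a)⁻¹ * g z := by
  have hm := meromorphicAt_of_nf hf a
  have hne : meromorphicOrderAt f a ≠ ⊤ := fun h => by
    rw [IsPole, h] at ha; exact not_top_lt ha
  obtain ⟨n, hn⟩ := WithTop.ne_top_iff_exists.1 hne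
  have hn0 : n < 0 := by
    have : meromorphicOrderAt f a < 0 := ha
    rw [← hn] at this; exact_mod_cast this
  have hmul : ((poleMultiplicity f a : ℕ) : ℤ) = -n := by
    rw [poleMultiplicity, ← hn, WithTop.untop₀_coe]; omega
  refine ⟨by omega, ?_⟩
  obtain ⟨g, hg, hg0, hfg⟩ := (meromorphicOrderAt_eq_int_iff hm).1 hn.symm
  refine ⟨g, hg, hg0, ?_⟩
  filter_upwards [hfg] with z hz
  rw [hz, smul_eq_mul, ← zpow_natCast, hmul, zpow_neg, inv_inv]

/-- Near a pole of multiplicity `m` there is a coordinate `e` with `e ^ m = 1 / f`. -/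
theorem exists_pole_coordinate {f : ℂ → ℂ} {a : ℂ} (hf : MeromorphicNFOn f univ)
    (ha : IsPole f a) : ∃ e : OpenPartialHomeomorph ℂ ℂ, a ∈ e.source ∧ e a = 0 ∧
      (∀ z ∈ e.source, z ≠ a → ¬ IsPole f z ∧ e z ^ poleMultiplicity f a = (f z)⁻¹) ∧
      DifferentiableOn ℂ e.symm e.target := by
  obtain ⟨hm, g, hg, hg0, hfg⟩ := exists_pole_factorization hf ha
  set m := poleMultiplicity f a
  obtain ⟨c, hc⟩ := IsAlgClosed.exists_pow_nat_eq (g a)⁻¹ hm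
  have hc0 : c ≠ 0 := by rintro rfl; rw [zero_pow hm.ne'] at hc; exact inv_ne_zero hg0 hc.symm
  -- `k` is an `m`-th root of `1/g` near `a`; the quotient `g z / g a` is near `1`, where the
  -- principal logarithm is analytic.
  set k : ℂ → ℂ := fun z => c * Complex.exp (-Complex.log (g z / g a) / m) with hk
  have hslit : g a / g a ∈ Complex.slitPlane := by
    rw [div_self hg0]; exact Complex.one_mem_slitPlane
  have hdiv : AnalyticAt ℂ (fun z => g z / g a) a := hg.div analyticAt_const hg0
  have hka : AnalyticAt ℂ k a :=
    analyticAt_const.mul ((((hdiv.clog hslit).neg).div analyticAt_const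
      (Nat.cast_ne_zero.2 hm.ne')).cexp)
  set ψ : ℂ → ℂ := fun z => (z - a) * k z with hψ
  have hψa : AnalyticAt ℂ ψ a := (analyticAt_id.sub analyticAt_const).mul hka
  have hk0 : k a ≠ 0 := mul_ne_zero hc0 (Complex.exp_ne_zero _)
  have hderiv : deriv ψ a = k a := by
    have h1 : HasDerivAt (fun z : ℂ => z - a) 1 a := (hasDerivAt_id a).sub_const a
    have h2 := h1.mul hka.differentiableAt.hasDerivAt
    have h3 : HasDerivAt ψ (1 * k a + (a - a) * deriv k a) a := h2
    rw [h3.deriv]; ring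
  have hd0 : deriv ψ a ≠ 0 := hderiv ▸ hk0
  have hs := hψa.hasStrictDerivAt.hasStrictFDerivAt_equiv hd0
  have hgood : ∀ᶠ z in 𝓝 a, AnalyticAt ℂ ψ z ∧ deriv ψ z ≠ 0 ∧
      (z ≠ a → ¬ IsPole f z ∧ ψ z ^ m = (f z)⁻¹) := by
    refine hψa.eventually_analyticAt.and ((hψa.deriv.continuousAt.eventually_ne hd0).and ?_)
    have h1 := eventually_nhdsWithin_iff.1 hfg
    have h2 := eventually_nhdsWithin_iff.1 (eventually_not_isPole hf a)
    have h3 := hg.continuousAt.eventually_ne hg0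
    filter_upwards [h1, h2, h3] with z h1 h2 h3 hza
    refine ⟨h2 hza, ?_⟩
    rw [h1 hza]
    have h4 : k z ^ m = (g z)⁻¹ := by
      simp only [hk]
      rw [mul_pow, hc, ← Complex.exp_nat_mul, mul_div_cancel₀ _ (Nat.cast_ne_zero.2 hm.ne'),
        Complex.exp_neg, Complex.exp_log (div_ne_zero h3 hg0)]
      field_simp
    simp only [hψ]
    rw [mul_pow, h4, mul_inv, inv_inv]
  obtain ⟨U, hU, hUo, haU⟩ := eventually_nhds_iff.1 hgood
  set e := (hs.toOpenPartialHomeomorph ψ).restrOpen U hUo with he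
  have hecoe : ∀ z, e z = ψ z := fun z => rfl
  have hsrc : ∀ z ∈ e.source, z ∈ U := fun z hz => by
    rw [he, OpenPartialHomeomorph.restrOpen_source] at hz; exact hz.2
  refine ⟨e, ?_, by rw [hecoe]; simp [hψ], fun z hz hza => ?_, fun w hw => ?_⟩
  · rw [he, OpenPartialHomeomorph.restrOpen_source]
    exact ⟨hs.mem_toOpenPartialHomeomorph_source, haU⟩
  · rw [hecoe]; exact (hU z (hsrc z hz)).2.2 hza
  · have hz := hU _ (hsrc _ (e.map_target hw))
    have h1 : HasDerivAt e (deriv ψ (e.symm w)) (e.symm w) := hz.1.differentiableAt.hasDerivAt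
    exact (e.hasDerivAt_symm hw hz.2.1 h1).differentiableAt.differentiableWithinAt

/-- The radius of the disc that parametrises the component of `{|f| > R}` at a pole of
multiplicity `m`. -/
noncomputable def tractRadius (R : ℝ) (m : ℕ) : ℝ := R ^ (-(1 / (m : ℝ)))

theorem tractRadius_pos {R : ℝ} (hR : 0 < R) (m : ℕ) : 0 < tractRadius R m := Real.rpow_pos_of_pos hR _

theorem tractRadius_pow {R : ℝ} (hR : 0 < R) {m : ℕ} (hm : 0 < m) : tractRadius R m ^ m = R⁻¹ := by
  rw [tractRadius, ← Real.rpow_natCast, ← Real.rpow_mul hR.le]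
  have : -(1 / (m : ℝ)) * m = -1 := by field_simp
  rw [this, Real.rpow_neg_one]

theorem lt_tractRadius_iff {R : ℝ} (hR : 0 < R) {m : ℕ} (hm : 0 < m) {x : ℝ} (hx : 0 ≤ x) :
    x < tractRadius R m ↔ x ^ m < R⁻¹ := by
  rw [← tractRadius_pow hR hm, pow_lt_pow_iff_left₀ hx (tractRadius_pos hR m).le hm.ne']

theorem lt_norm_inv_pow {R : ℝ} (hR : 0 < R) {m : ℕ} (hm : 0 < m) {u : ℂ} (hu0 : u ≠ 0)
    (hu : ‖u‖ < tractRadius R m) : R < ‖(u ^ m)⁻¹‖ := by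
  rw [norm_inv, norm_pow]
  exact (lt_inv_comm₀ (by positivity) hR).1 ((lt_tractRadius_iff hR hm (norm_nonneg u)).1 hu)

/-- `G` maps the disc of radius `tractRadius R m` to the component of `{|f| > R}` at the pole `a`
of multiplicity `m`, in such a way that `f (G u) = u ^ (-m)`. -/
structure IsTractMap (f : ℂ → ℂ) (R : ℝ) (a : ℂ) (G : ℂ → ℂ) : Prop where
  isPole : IsPole f a
  map_zero : G 0 = a
  differentiableOn : DifferentiableOn ℂ G (Metric.ball 0 (tractRadius R (poleMultiplicity f a)))
  mem_highSet : ∀ u ∈ Metric.ball (0 : ℂ) (tractRadius R (poleMultiplicity f a)), u ≠ 0 →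
    G u ∈ highSet f R
  apply_eq : ∀ u ∈ Metric.ball (0 : ℂ) (tractRadius R (poleMultiplicity f a)), u ≠ 0 →
    f (G u) = (u ^ poleMultiplicity f a)⁻¹
  locally_injective : ∃ ε > 0, InjOn G (Metric.ball 0 ε)
  locally_surjective : ∀ᶠ z in 𝓝 a,
    ∃ u ∈ Metric.ball (0 : ℂ) (tractRadius R (poleMultiplicity f a)), G u = z

variable {f : ℂ → ℂ} {R : ℝ} {a : ℂ}

-- The local coordinate at the pole supplies `G` near `0`. For any other `u`, lift the curve `(c
-- u)^(-m)` as `c` grows from a small value to `1`, starting from the local coordinate. Lifts depend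
-- continuously on `u`, and `G` is analytic because it is locally an inverse branch of `f` applied
-- to `u^(-m)`.
open unitInterval in
theorem RegularAbove.exists_isTractMap (h : RegularAbove f R) (ha : IsPole f a) :
    ∃ G, IsTractMap f R a G := by
  have hR : 0 < R := zero_lt_one.trans_le h.one_le
  obtain ⟨e, hea, hea0, hef, hed⟩ := exists_pole_coordinate h.nf ha
  have hm : 0 < poleMultiplicity f a := (exists_pole_factorization h.nf ha).1
  set m := poleMultiplicity f a with hmdef
  set r := tractRadius R m with hr
  have hr0 : 0 < r := tractRadius_pos hR m
  have htar0 : (0 : ℂ) ∈ e.target := hea0 ▸ e.map_source hea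
  have hsymm0 : e.symm 0 = a := by rw [← hea0, e.left_inv hea]
  obtain ⟨ε₁, hε₁, hball₁⟩ := Metric.isOpen_iff.1 e.open_target 0 htar0
  set ε := min ε₁ r with hεdef
  have hε : 0 < ε := lt_min hε₁ hr0
  have hball : ∀ u : ℂ, ‖u‖ < ε → u ∈ e.target := fun u hu =>
    hball₁ (mem_ball_zero_iff.2 (hu.trans_le (min_le_left _ _)))
  have hsne : ∀ u : ℂ, ‖u‖ < ε → u ≠ 0 → e.symm u ≠ a := fun u hu hu0 hcon => by
    apply hu0
    rw [← e.right_inv (hball u hu), hcon, hea0]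
  have hsf : ∀ u : ℂ, ‖u‖ < ε → u ≠ 0 → f (e.symm u) = (u ^ m)⁻¹ := fun u hu hu0 => by
    have := (hef _ (e.map_target (hball u hu)) (hsne u hu hu0)).2
    rw [e.right_inv (hball u hu)] at this
    rw [this, inv_inv]
  have hsh : ∀ u : ℂ, ‖u‖ < ε → u ≠ 0 → e.symm u ∈ highSet f R := fun u hu hu0 => by
    refine ⟨(hef _ (e.map_target (hball u hu)) (hsne u hu hu0)).1, ?_⟩
    rw [hsf u hu hu0]
    exact lt_norm_inv_pow hR hm hu0 (hu.trans_le (min_le_right _ _))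
  set A : Set ℂ := {u | u ≠ 0 ∧ ‖u‖ < r} with hA
  have hAo : IsOpen A := by
    rw [hA]; exact (isOpen_ne).inter (isOpen_lt continuous_norm continuous_const)
  -- The factor `κ` moves the whole disc of radius `r` into the disc of radius `ε` where the local
  -- coordinate lives. The path `c` below runs from `κ` at time `0` to `1` at time `1`.
  set κ : ℝ := ε / (2 * r) with hκ
  have hκ0 : 0 < κ := by positivity
  have hκ1 : κ < 1 := by
    rw [hκ, div_lt_one (by positivity)]; linarith [min_le_right ε₁ r]
  set c : ℝ → ℝ := fun t => κ + (1 - κ) * min t 1 with hc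
  have hcc : Continuous c := by fun_prop
  have hc0 : ∀ t, 0 ≤ t → 0 < c t := fun t ht =>
    add_pos_of_pos_of_nonneg hκ0 (mul_nonneg (by linarith) (le_min ht zero_le_one))
  have hc1 : ∀ t, c t ≤ 1 := fun t => by
    have : (1 - κ) * min t 1 ≤ (1 - κ) * 1 :=
      mul_le_mul_of_nonneg_left (min_le_right _ _) (by linarith)
    simp only [hc]; linarith
  have hcu0 : ∀ t, 0 ≤ t → ∀ u : ℂ, u ≠ 0 → (c t : ℂ) * u ≠ 0 := fun t ht u hu =>
    mul_ne_zero (Complex.ofReal_ne_zero.2 (hc0 t ht).ne') hu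
  have hcun : ∀ t, 0 ≤ t → ∀ u : ℂ, ‖(c t : ℂ) * u‖ ≤ ‖u‖ := fun t ht u => by
    rw [norm_mul, Complex.norm_real, Real.norm_of_nonneg (hc0 t ht).le]
    exact mul_le_of_le_one_left (norm_nonneg _) (hc1 t)
  have hκu : ∀ u : ℂ, ‖u‖ < r → ‖(c 0 : ℂ) * u‖ < ε := fun u hu => by
    rw [norm_mul, Complex.norm_real, Real.norm_of_nonneg (hc0 0 le_rfl).le]
    have : c 0 = κ := by simp [hc]
    rw [this, hκ, div_mul_eq_mul_div, div_lt_iff₀ (by positivity)]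
    nlinarith
  have hexists : ∀ u : A, ∃ g : ℝ → ℂ, ContinuousOn g (Ici 0) ∧ MapsTo g (Ici 0) (highSet f R) ∧
      (∀ t, 0 ≤ t → f (g t) = (((c t : ℂ) * u) ^ m)⁻¹) ∧ g 0 = e.symm ((c 0 : ℂ) * u) := by
    rintro ⟨u, hu0, hur⟩
    refine h.exists_lift (γ := fun t => (((c t : ℂ) * u) ^ m)⁻¹) ?_ ?_ (hsh _ (hκu u hur)
      (hcu0 0 le_rfl u hu0)) (hsf _ (hκu u hur) (hcu0 0 le_rfl u hu0))
    · refine ContinuousOn.inv₀ (by fun_prop) fun t ht => pow_ne_zero _ (hcu0 t ht u hu0)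
    · exact fun t ht => lt_norm_inv_pow hR hm (hcu0 t ht u hu0) ((hcun t ht u).trans_lt hur)
  choose g hgc hgm hgf hg0 using hexists
  -- Viewing all paths as one homotopy gives joint continuity of the lifts, hence continuity of `G`
  -- off `0`.
  let F : C(I × A, ℂ) := ⟨fun p => (((c p.1 : ℂ) * p.2) ^ m)⁻¹, by
    refine Continuous.inv₀ (by fun_prop) fun p => pow_ne_zero _ (hcu0 _ p.1.2.1 _ p.2.2.1)⟩
  let Γ : I × A → highSet f R := fun p => ⟨g p.2 p.1, hgm p.2 p.1.2.1⟩
  have hΓ : Continuous Γ := by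
    refine h.isLocalHomeomorph.continuous_lift (T2Space.isSeparatedMap _) F
      (funext fun p => hgf p.2 p.1 p.1.2.1) ?_ fun u => ?_
    · refine Continuous.subtype_mk ?_ _
      have : (fun u : A => g u ((0 : I) : ℝ)) = fun u : A => e.symm ((c 0 : ℂ) * u) := by
        funext u; simpa using hg0 u
      change Continuous (fun u : A => g u ((0 : I) : ℝ))
      rw [this]
      exact e.continuousOn_symm.comp_continuous (by fun_prop) fun u => hball _ (hκu u u.2.2)
    · refine Continuous.subtype_mk ?_ _
      exact (hgc u).comp_continuous continuous_subtype_val fun t => t.2.1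
  classical
  set G : ℂ → ℂ := fun u => if hu : u ∈ A then g ⟨u, hu⟩ 1 else a with hG
  have hGA : ∀ u (hu : u ∈ A), G u = g ⟨u, hu⟩ 1 := fun u hu => dif_pos hu
  have hG0 : G 0 = a := dif_neg fun h0 => h0.1 rfl
  have hGcont : ContinuousOn G A := by
    rw [continuousOn_iff_continuous_domRestrict]
    have h1 : Continuous fun u : A => ((Γ (1, u) : highSet f R) : ℂ) :=
      continuous_subtype_val.comp (hΓ.comp (Continuous.prodMk_right (1 : I)))
    refine h1.congr fun u => ?_
    simp [Γ, hGA u u.2]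
  have hc1' : c 1 = 1 := by simp [hc]
  have hGf : ∀ u ∈ A, f (G u) = (u ^ m)⁻¹ := fun u hu => by
    rw [hGA u hu, hgf ⟨u, hu⟩ 1 zero_le_one, hc1']; simp
  have hGh : ∀ u ∈ A, G u ∈ highSet f R := fun u hu => by
    rw [hGA u hu]; exact hgm ⟨u, hu⟩ (mem_Ici.2 zero_le_one)
  have hagree : ∀ u : ℂ, ‖u‖ < ε → G u = e.symm u := fun u hu => by
    by_cases hu0 : u = 0
    · rw [hu0, hG0, hsymm0]
    have huA : u ∈ A := ⟨hu0, hu.trans_le (min_le_right _ _)⟩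
    have hlt : ∀ t, 0 ≤ t → ‖(c t : ℂ) * u‖ < ε := fun t ht => (hcun t ht u).trans_lt hu
    have := h.eqOn_of_lifts (isPreconnected_Ici (a := (0 : ℝ))) (hgc ⟨u, huA⟩)
      (g₂ := fun t => e.symm ((c t : ℂ) * u))
      (e.continuousOn_symm.comp (by fun_prop) fun t ht => hball _ (hlt t ht)) (hgm ⟨u, huA⟩)
      (fun t ht => hsh _ (hlt t ht) (hcu0 t ht u hu0))
      (fun t ht => (hgf ⟨u, huA⟩ t ht).trans (hsf _ (hlt t ht) (hcu0 t ht u hu0)).symm)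
      (mem_Ici.2 (le_refl (0 : ℝ))) (hg0 ⟨u, huA⟩)
    have h1 := this (mem_Ici.2 zero_le_one)
    simp only [hc1', Complex.ofReal_one, one_mul] at h1
    rw [hGA u huA, h1]
  have hmemA : ∀ u ∈ Metric.ball (0 : ℂ) r, u ≠ 0 → u ∈ A := fun u hu hu0 =>
    ⟨hu0, mem_ball_zero_iff.1 hu⟩
  refine ⟨G, ha, hG0, ?_, fun u hu hu0 => hGh u (hmemA u hu hu0),
    fun u hu hu0 => hGf u (hmemA u hu hu0), ⟨ε, hε, ?_⟩, ?_⟩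
  · intro u hu
    apply DifferentiableAt.differentiableWithinAt
    by_cases hu0 : u = 0
    · have h1 : DifferentiableAt ℂ e.symm u :=
        (hed u (hu0 ▸ htar0)).differentiableAt (e.open_target.mem_nhds (hu0 ▸ htar0))
      refine h1.congr_of_eventuallyEq ?_
      filter_upwards [Metric.ball_mem_nhds u hε] with v hv
      refine hagree v ?_
      simpa [hu0] using hv
    · have huA := hmemA u hu hu0
      have hGu := hGcont.continuousAt (hAo.mem_nhds huA)
      have hfan := h.analyticAt (hGh u huA)
      have hd := h.deriv_ne_zero (hGh u huA)
      have hL := hfan.analyticAt_localInverse hd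
      set L := hfan.hasStrictDerivAt.localInverse _ _ _ hd
      have hleft : ∀ᶠ z in 𝓝 (G u), L (f z) = z :=
        (hfan.hasStrictDerivAt.hasStrictFDerivAt_equiv hd).eventually_left_inverse
      have hev : G =ᶠ[𝓝 u] fun v => L ((v ^ m)⁻¹) := by
        filter_upwards [hGu.eventually hleft, hAo.mem_nhds huA] with v hv hvA
        rw [← hGf v hvA, hv]
      refine DifferentiableAt.congr_of_eventuallyEq ?_ hev
      have h2 : DifferentiableAt ℂ (fun v : ℂ => (v ^ m)⁻¹) u :=
        (differentiableAt_pow m).inv (pow_ne_zero _ hu0)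
      have h3 : DifferentiableAt ℂ L ((u ^ m)⁻¹) := by
        rw [← hGf u huA]; exact hL.differentiableAt
      exact h3.comp u h2
  · intro u hu v hv huv
    rw [mem_ball_zero_iff] at hu hv
    rw [hagree u hu, hagree v hv] at huv
    exact e.symm.injOn (hball u hu) (hball v hv) huv
  · have h1 : ∀ᶠ z in 𝓝 a, ‖e z‖ < ε := by
      have := (e.continuousAt hea).norm
      rw [ContinuousAt, hea0, norm_zero] at this
      exact this.eventually (gt_mem_nhds hε)
    filter_upwards [h1, e.open_source.mem_nhds hea] with z hz hzs
    exact ⟨e z, mem_ball_zero_iff.2 (hz.trans_le (min_le_right _ _)), by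
      rw [hagree _ hz, e.left_inv hzs]⟩

namespace IsTractMap

variable {b : ℂ} {G H : ℂ → ℂ}

theorem poleMultiplicity_pos (h : RegularAbove f R) (hG : IsTractMap f R a G) :
    0 < poleMultiplicity f a := (exists_pole_factorization h.nf hG.isPole).1

theorem tendsto_zero (h : RegularAbove f R) (hG : IsTractMap f R a G) :
    Tendsto G (𝓝 0) (𝓝 a) := by
  have hR : 0 < R := zero_lt_one.trans_le h.one_le
  have := (hG.differentiableOn.continuousOn.continuousAt
    (Metric.ball_mem_nhds 0 (tractRadius_pos hR _))).tendsto
  rwa [hG.map_zero] at this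

/-- Shrinking `u` by `exp (-t/m)` multiplies `f` by `exp t`, whatever the multiplicity. Two radial
curves that start at the same point are therefore lifts of the same ray and coincide. -/
theorem radial_eqOn (h : RegularAbove f R) (hG : IsTractMap f R a G) (hH : IsTractMap f R b H)
    {u v : ℂ} (hu : ‖u‖ < tractRadius R (poleMultiplicity f a))
    (hv : ‖v‖ < tractRadius R (poleMultiplicity f b)) (hu0 : u ≠ 0) (hv0 : v ≠ 0)
    (huv : G u = H v) {t : ℝ} (ht : 0 ≤ t) :
    G (Real.exp (-t / poleMultiplicity f a) * u) = H (Real.exp (-t / poleMultiplicity f b) * v) := by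
  have key : ∀ {a : ℂ} {G : ℂ → ℂ}, IsTractMap f R a G → ∀ {u : ℂ},
      ‖u‖ < tractRadius R (poleMultiplicity f a) → u ≠ 0 → 
      ContinuousOn (fun t : ℝ => G (Real.exp (-t / poleMultiplicity f a) * u)) (Ici 0) ∧
      MapsTo (fun t : ℝ => G (Real.exp (-t / poleMultiplicity f a) * u)) (Ici 0) (highSet f R) ∧
      ∀ t ∈ Ici (0 : ℝ), f (G (Real.exp (-t / poleMultiplicity f a) * u)) = Real.exp t * f (G u) := by
    intro a G hG u hu hu0
    have hm := hG.poleMultiplicity_pos h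
    set m := poleMultiplicity f a with hmd
    have hin : ∀ t ∈ Ici (0 : ℝ), (Real.exp (-t / m) : ℂ) * u ∈ Metric.ball (0 : ℂ) (tractRadius R m) := by
      intro t ht
      rw [mem_ball_zero_iff, norm_mul, Complex.norm_real, Real.norm_of_nonneg (Real.exp_pos _).le]
      refine (mul_le_of_le_one_left (norm_nonneg _) (Real.exp_le_one_iff.2 ?_)).trans_lt hu
      exact div_nonpos_of_nonpos_of_nonneg (neg_nonpos.2 ht) (Nat.cast_nonneg _)
    have hne : ∀ t : ℝ, (Real.exp (-t / m) : ℂ) * u ≠ 0 := fun t =>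
      mul_ne_zero (Complex.ofReal_ne_zero.2 (Real.exp_pos _).ne') hu0
    refine ⟨hG.differentiableOn.continuousOn.comp (by fun_prop) hin,
      fun t ht => hG.mem_highSet _ (hin t ht) (hne t), fun t ht => ?_⟩
    rw [hG.apply_eq _ (hin t ht) (hne t), hG.apply_eq _ (mem_ball_zero_iff.2 hu) hu0, mul_pow,
      mul_inv, ← hmd]
    congr 1
    rw [← Complex.ofReal_pow, ← Real.exp_nat_mul, ← Complex.ofReal_inv, ← Real.exp_neg]
    congr 2
    field_simp
  obtain ⟨c₁, m₁, e₁⟩ := key hG hu hu0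
  obtain ⟨c₂, m₂, e₂⟩ := key hH hv hv0
  exact h.eqOn_of_lifts isPreconnected_Ici c₁ c₂ m₁ m₂
    (fun t ht => by rw [e₁ t ht, e₂ t ht, huv]) (mem_Ici.2 (le_refl (0 : ℝ))) (by simpa using huv) ht

theorem tendsto_radial {m : ℕ} (hm : 0 < m) (u : ℂ) :
    Tendsto (fun t : ℝ => (Real.exp (-t / m) : ℂ) * u) atTop (𝓝 0) := by
  have h1 : Tendsto (fun t : ℝ => -t / m) atTop atBot :=
    tendsto_neg_atTop_atBot.atBot_div_const (Nat.cast_pos.2 hm)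
  have h2 := (Complex.continuous_ofReal.tendsto 0).comp (Real.tendsto_exp_atBot.comp h1)
  simpa using h2.mul_const u

theorem ne_of_ne_zero (hG : IsTractMap f R a G) {u : ℂ}
    (hu : ‖u‖ < tractRadius R (poleMultiplicity f a)) (hu0 : u ≠ 0) : ¬ IsPole f (G u) :=
  (hG.mem_highSet u (mem_ball_zero_iff.2 hu) hu0).1

/-- A coincidence `G u = G v` moves along the radial curves into the small disc where injectivity is
already known. -/
theorem injOn (h : RegularAbove f R) (hG : IsTractMap f R a G) :
    InjOn G (Metric.ball 0 (tractRadius R (poleMultiplicity f a))) := by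
  intro u hu v hv huv
  rw [mem_ball_zero_iff] at hu hv
  by_cases hu0 : u = 0
  · by_contra hne
    have hv0 : v ≠ 0 := fun hv0 => hne (hu0.trans hv0.symm)
    refine hG.ne_of_ne_zero hv hv0 ?_
    rw [← huv, hu0, hG.map_zero]; exact hG.isPole
  by_cases hv0 : v = 0
  · exfalso
    refine hG.ne_of_ne_zero hu hu0 ?_
    rw [huv, hv0, hG.map_zero]; exact hG.isPole
  obtain ⟨ε, hε, hinj⟩ := hG.locally_injective
  have hm := hG.poleMultiplicity_pos h
  have h1 := (tendsto_radial hm u).eventually (Metric.ball_mem_nhds 0 hε)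
  have h2 := (tendsto_radial hm v).eventually (Metric.ball_mem_nhds 0 hε)
  obtain ⟨t, h1, h2, ht⟩ := (h1.and (h2.and (eventually_ge_atTop 0))).exists
  have := hinj h1 h2 (radial_eqOn h hG hG hu hv hu0 hv0 huv ht)
  exact mul_left_cancel₀ (Complex.ofReal_ne_zero.2 (Real.exp_pos _).ne') this

/-- Disjointness of tracts: from a common point the two radial curves agree, and they converge to
`a` and to `b`. -/
theorem eq_of_apply_eq (h : RegularAbove f R) (hG : IsTractMap f R a G) (hH : IsTractMap f R b H)
    {u v : ℂ} (hu : ‖u‖ < tractRadius R (poleMultiplicity f a))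
    (hv : ‖v‖ < tractRadius R (poleMultiplicity f b)) (huv : G u = H v) : a = b := by
  by_cases hu0 : u = 0
  · by_cases hv0 : v = 0
    · rw [← hG.map_zero, ← hH.map_zero, ← hu0, huv, hv0, hu0]
    · refine absurd ?_ (hH.ne_of_ne_zero hv hv0)
      rw [← huv, hu0, hG.map_zero]; exact hG.isPole
  by_cases hv0 : v = 0
  · refine absurd ?_ (hG.ne_of_ne_zero hu hu0)
    rw [huv, hv0, hH.map_zero]; exact hH.isPole
  have h1 := (hG.tendsto_zero h).comp (tendsto_radial (hG.poleMultiplicity_pos h) u)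
  have h2 := (hH.tendsto_zero h).comp (tendsto_radial (hH.poleMultiplicity_pos h) v)
  refine tendsto_nhds_unique h1 (h2.congr' ?_)
  filter_upwards [eventually_ge_atTop 0] with t ht
  exact (radial_eqOn h hG hH hu hv hu0 hv0 huv ht).symm

end IsTractMap

/-- Every point of `highSet f R` lies in the image of a tract map. -/
theorem RegularAbove.exists_mem_tract (h : RegularAbove f R) {T : ℂ → ℂ → ℂ}
    (hT : ∀ a, IsPole f a → IsTractMap f R a (T a)) {z : ℂ} (hz : z ∈ highSet f R) :
    ∃ a, IsPole f a ∧ ∃ u, u ≠ 0 ∧ ‖u‖ < tractRadius R (poleMultiplicity f a) ∧ T a u = z := by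
  have hR : 0 < R := zero_lt_one.trans_le h.one_le
  have hfz : 0 < ‖f z‖ := hR.trans hz.2
  have hfz0 : f z ≠ 0 := norm_pos_iff.1 hfz
  have hγn : ∀ t : ℝ, ‖f z * Real.exp t‖ = ‖f z‖ * Real.exp t := fun t => by
    rw [norm_mul, Complex.norm_real, Real.norm_of_nonneg (Real.exp_pos _).le]
  -- The ray from `f z` to `∞` lifts to a curve from `z` that ends at a pole, so it finally runs
  -- inside that tract. There it is radial, and uniqueness of lifts lets the radial curve be
  -- followed back to `z`.
  obtain ⟨g, hgc, hgm, hgf, hg0⟩ := h.exists_lift (γ := fun t : ℝ => f z * Real.exp t)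
    (by fun_prop) (fun t ht => by
      rw [hγn]
      exact hz.2.trans_le (le_mul_of_one_le_right hfz.le (Real.one_le_exp ht))) hz (by simp)
  obtain ⟨a, ha, hlim⟩ := h.exists_tendsto_pole hgc hgm (by
    rw [← tendsto_norm_atTop_iff_cobounded]
    refine (Real.tendsto_exp_atTop.const_mul_atTop hfz).congr' ?_
    filter_upwards [eventually_ge_atTop 0] with t ht
    rw [hgf t ht, hγn])
  have hG := hT a ha
  set G := T a
  have hm := hG.poleMultiplicity_pos h
  set m := poleMultiplicity f a with hmd
  obtain ⟨t₀, ⟨u₀, hu₀, hGu₀⟩, ht₀⟩ :=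
    ((hlim.eventually hG.locally_surjective).and (eventually_ge_atTop 0)).exists
  have hu₀0 : u₀ ≠ 0 := by
    rintro rfl
    exact (hgm (mem_Ici.2 ht₀)).1 (by rw [← hGu₀, hG.map_zero]; exact ha)
  have hval : (u₀ ^ m)⁻¹ = f z * Real.exp t₀ := by
    rw [← hgf t₀ ht₀, ← hGu₀, hG.apply_eq u₀ hu₀ hu₀0]
  have hne : ∀ t : ℝ, (Real.exp ((t₀ - t) / m) : ℂ) * u₀ ≠ 0 := fun t =>
    mul_ne_zero (Complex.ofReal_ne_zero.2 (Real.exp_pos _).ne') hu₀0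
  have hpow : ∀ t : ℝ, (((Real.exp ((t₀ - t) / m) : ℂ) * u₀) ^ m)⁻¹ = f z * Real.exp t := by
    intro t
    rw [mul_pow, mul_inv, hval, ← Complex.ofReal_pow, ← Real.exp_nat_mul]
    have : (m : ℝ) * ((t₀ - t) / m) = t₀ - t := by field_simp
    rw [this, Real.exp_sub]
    push_cast
    field_simp
  have hin : ∀ t : ℝ, 0 ≤ t →
      (Real.exp ((t₀ - t) / m) : ℂ) * u₀ ∈ Metric.ball (0 : ℂ) (tractRadius R m) := by
    intro t ht
    rw [mem_ball_zero_iff, lt_tractRadius_iff hR hm (norm_nonneg _), ← norm_pow]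
    have h1 : R < ‖(((Real.exp ((t₀ - t) / m) : ℂ) * u₀) ^ m)⁻¹‖ := by
      rw [hpow, hγn]
      exact hz.2.trans_le (le_mul_of_one_le_right hfz.le (Real.one_le_exp ht))
    rw [norm_inv] at h1
    exact (lt_inv_comm₀ hR (norm_pos_iff.2 (pow_ne_zero _ (hne t)))).1 h1
  have := h.eqOn_of_lifts (isPreconnected_Ici (a := (0 : ℝ))) hgc
    (g₂ := fun t => G ((Real.exp ((t₀ - t) / m) : ℂ) * u₀))
    (hG.differentiableOn.continuousOn.comp (by fun_prop) fun t ht => hin t ht) hgm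
    (fun t ht => hG.mem_highSet _ (hin t ht) (hne t))
    (fun t ht => by rw [hgf t ht, hG.apply_eq _ (hin t ht) (hne t), hpow])
    (mem_Ici.2 ht₀) (by simpa using hGu₀.symm)
  refine ⟨a, ha, _, hne 0, mem_ball_zero_iff.1 (hin 0 le_rfl), ?_⟩
  rw [← hg0]
  exact (this (mem_Ici.2 (le_refl (0 : ℝ)))).symm

end MeroDyn

/-! ### Logarithmic area and distortion. -/

namespace MeroDyn

open MeasureTheory

theorem abs_det_toSpanSingleton_restrictScalars (c : ℂ) :
    |((ContinuousLinearMap.toSpanSingleton ℂ c).restrictScalars ℝ).det| = ‖c‖ ^ 2 := by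
  simp [ContinuousLinearMap.det, LinearMap.det_restrictScalars, Algebra.norm_complex_eq,
    Complex.normSq_eq_norm_sq]

theorem lintegral_image_holomorphic {G G' : ℂ → ℂ} {E : Set ℂ} (hE : MeasurableSet E)
    (hG : ∀ u ∈ E, HasDerivAt G (G' u) u) (hinj : InjOn G E) (w : ℂ → ENNReal) :
    ∫⁻ z in G '' E, w z = ∫⁻ u in E, ENNReal.ofReal (‖G' u‖ ^ 2) * w (G u) := by
  rw [lintegral_image_eq_lintegral_abs_det_fderiv_mul volume hE
    (f' := fun u => (ContinuousLinearMap.toSpanSingleton ℂ (G' u)).restrictScalars ℝ)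
    (fun u hu => ((hG u hu).hasFDerivAt.restrictScalars ℝ).hasFDerivWithinAt) hinj]
  simp_rw [abs_det_toSpanSingleton_restrictScalars]

/-- The weight `|z|⁻²`, which is the density of the area of the logarithmic metric. -/
noncomputable def logDensity (z : ℂ) : ENNReal := (ENNReal.ofReal (‖z‖ ^ 2))⁻¹

theorem mul_logDensity {c z : ℂ} (hz : z ≠ 0) :
    ENNReal.ofReal (‖c‖ ^ 2) * logDensity z = ENNReal.ofReal (‖c / z‖ ^ 2) := by
  have : 0 < ‖z‖ ^ 2 := by positivity
  rw [logDensity, ← ENNReal.ofReal_inv_of_pos this, ← ENNReal.ofReal_mul (by positivity), norm_div,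
    div_pow, div_eq_mul_inv]

theorem setLIntegral_logDensity_image {G : ℂ → ℂ} {E : Set ℂ} (hE : MeasurableSet E)
    (hG : ∀ u ∈ E, DifferentiableAt ℂ G u) (hinj : InjOn G E) (h0 : ∀ u ∈ E, G u ≠ 0) :
    ∫⁻ z in G '' E, logDensity z = ∫⁻ u in E, ENNReal.ofReal (‖deriv G u / G u‖ ^ 2) := by
  rw [lintegral_image_holomorphic hE (fun u hu => (hG u hu).hasDerivAt) hinj]
  exact setLIntegral_congr_fun hE fun u hu => mul_logDensity (h0 u hu)

/-- The exponential is injective on a rectangle of sides `b - a` and `2π` whose image covers the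
annulus, and it pulls `logDensity` back to Lebesgue measure. -/
theorem setLIntegral_logDensity_annulus_le (a b : ℝ) :
    ∫⁻ z in {z : ℂ | Real.exp a ≤ ‖z‖ ∧ ‖z‖ ≤ Real.exp b}, logDensity z ≤
      ENNReal.ofReal ((b - a) * (2 * Real.pi)) := by
  set S : Set ℂ := Complex.measurableEquivRealProd ⁻¹' (Icc a b ×ˢ Ioc (-Real.pi) Real.pi) with hS
  have hSm : MeasurableSet S :=
    Complex.measurableEquivRealProd.measurable (measurableSet_Icc.prod measurableSet_Ioc)
  have hSmem : ∀ z : ℂ, z ∈ S ↔ (a ≤ z.re ∧ z.re ≤ b) ∧ (-Real.pi < z.im ∧ z.im ≤ Real.pi) :=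
    fun z => Iff.rfl
  have hsub : {z : ℂ | Real.exp a ≤ ‖z‖ ∧ ‖z‖ ≤ Real.exp b} ⊆ Complex.exp '' S := by
    rintro z ⟨h1, h2⟩
    have hz : 0 < ‖z‖ := (Real.exp_pos a).trans_le h1
    refine ⟨Complex.log z, (hSmem _).2 ⟨⟨?_, ?_⟩, Complex.neg_pi_lt_log_im z,
      Complex.log_im_le_pi z⟩, Complex.exp_log (norm_pos_iff.1 hz)⟩
    · rw [Complex.log_re]; exact (Real.le_log_iff_exp_le hz).2 h1
    · rw [Complex.log_re]; exact (Real.log_le_iff_le_exp hz).2 h2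
  have hinj : InjOn Complex.exp S := fun x hx y hy hxy =>
    Complex.exp_inj_of_neg_pi_lt_of_le_pi ((hSmem x).1 hx).2.1 ((hSmem x).1 hx).2.2
      ((hSmem y).1 hy).2.1 ((hSmem y).1 hy).2.2 hxy
  calc ∫⁻ z in {z : ℂ | Real.exp a ≤ ‖z‖ ∧ ‖z‖ ≤ Real.exp b}, logDensity z
      ≤ ∫⁻ z in Complex.exp '' S, logDensity z := lintegral_mono_set hsub
    _ = ∫⁻ u in S, ENNReal.ofReal (‖deriv Complex.exp u / Complex.exp u‖ ^ 2) :=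
        setLIntegral_logDensity_image hSm (fun u _ => Complex.differentiable_exp u) hinj
          fun u _ => Complex.exp_ne_zero u
    _ = volume S := by simp
    _ = ENNReal.ofReal ((b - a) * (2 * Real.pi)) := by
        rw [hS, Complex.volume_preserving_equiv_real_prod.measure_preimage_equiv,
          Measure.volume_eq_prod, Measure.prod_prod, Real.volume_Icc, Real.volume_Ioc,
          ENNReal.ofReal_mul' (by positivity)]
        congr 2; ring
    _ ≤ _ := le_rfl

/-- A holomorphic function on a disc has, on a suitable smaller disc of radius `δ`, values of size
comparable to the central one, and `δ` times this value bounds the function. -/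
theorem exists_disc_almost_max {q : ℂ → ℂ} {r s : ℝ} (hs : 0 < s) (hsr : s < r)
    (hq : DifferentiableOn ℂ q (Metric.ball 0 r)) :
    ∃ u₀ : ℂ, ∃ δ : ℝ, 0 < δ ∧ Metric.ball u₀ δ ⊆ Metric.ball 0 s ∧
      (∀ u ∈ Metric.ball u₀ δ, ‖q u‖ ≤ 2 * ‖q u₀‖) ∧
      (∀ u ∈ Metric.ball (0 : ℂ) s, (s - ‖u‖) * ‖q u‖ ≤ 2 * (δ * ‖q u₀‖)) ∧
      ENNReal.ofReal ((δ * ‖q u₀‖) ^ 2 / 100) ≤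
        ∫⁻ u in Metric.ball u₀ δ, ENNReal.ofReal (‖q u‖ ^ 2) := by
  by_cases hzero : ∀ u ∈ Metric.ball (0 : ℂ) s, q u = 0
  · refine ⟨0, s, hs, subset_rfl, fun u hu => by rw [hzero u hu, norm_zero]; positivity,
      fun u hu => by rw [hzero u hu, norm_zero, mul_zero]; positivity, ?_⟩
    rw [hzero 0 (Metric.mem_ball_self hs)]; simp
  push Not at hzero
  obtain ⟨u₁, hu₁, hqu₁⟩ := hzero
  have hsub : Metric.closedBall (0 : ℂ) s ⊆ Metric.ball 0 r := Metric.closedBall_subset_ball hsr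
  -- Take `u₀` maximising `(s - |u|) |q u|` and let `δ` be half its distance to the boundary circle.
  -- Then `s - |u|` is at least `δ` on the disc about `u₀`, so `|q|` at most doubles there.
  have hcont : ContinuousOn (fun u : ℂ => (s - ‖u‖) * ‖q u‖) (Metric.closedBall 0 s) :=
    ContinuousOn.mul (by fun_prop) (hq.continuousOn.mono hsub).norm
  obtain ⟨u₀, hu₀, hmax⟩ := (isCompact_closedBall (0 : ℂ) s).exists_isMaxOn
    ⟨0, Metric.mem_closedBall_self hs.le⟩ hcont
  have hmax' : ∀ u : ℂ, ‖u‖ ≤ s → (s - ‖u‖) * ‖q u‖ ≤ (s - ‖u₀‖) * ‖q u₀‖ := fun u hu =>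
    hmax (mem_closedBall_zero_iff.2 hu)
  rw [mem_ball_zero_iff] at hu₁
  rw [mem_closedBall_zero_iff] at hu₀
  have hpos : 0 < (s - ‖u₀‖) * ‖q u₀‖ :=
    (mul_pos (sub_pos.2 hu₁) (norm_pos_iff.2 hqu₁)).trans_le (hmax' u₁ hu₁.le)
  have hq₀ : 0 < ‖q u₀‖ := by
    by_contra h
    have : ‖q u₀‖ = 0 := le_antisymm (not_lt.1 h) (norm_nonneg _)
    rw [this, mul_zero] at hpos; exact lt_irrefl _ hpos
  have hsu : 0 < s - ‖u₀‖ := pos_of_mul_pos_left hpos hq₀.le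
  set δ : ℝ := (s - ‖u₀‖) / 2 with hδ
  have hδ0 : 0 < δ := by positivity
  have hnorm : ∀ u ∈ Metric.ball u₀ δ, ‖u‖ ≤ s - δ := fun u hu => by
    have h1 : ‖u‖ ≤ ‖u - u₀‖ + ‖u₀‖ := by simpa using norm_add_le (u - u₀) u₀
    have h2 : ‖u - u₀‖ < δ := by simpa [dist_eq_norm] using hu
    have h3 : ‖u₀‖ = s - 2 * δ := by rw [hδ]; ring
    linarith
  have hbound : ∀ u ∈ Metric.ball u₀ δ, ‖q u‖ ≤ 2 * ‖q u₀‖ := fun u hu => by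
    have h1 := hnorm u hu
    have h2 := hmax' u (by linarith)
    have h3 : δ * ‖q u‖ ≤ (s - ‖u‖) * ‖q u‖ :=
      mul_le_mul_of_nonneg_right (by linarith) (norm_nonneg _)
    have h4 : δ * ‖q u‖ ≤ δ * (2 * ‖q u₀‖) := by
      have : (s - ‖u₀‖) = 2 * δ := by rw [hδ]; ring
      rw [this] at h2; linarith
    exact le_of_mul_le_mul_left h4 hδ0
  have hballsub : Metric.ball u₀ δ ⊆ Metric.ball 0 s := fun u hu =>
    mem_ball_zero_iff.2 (by linarith [hnorm u hu])
  refine ⟨u₀, δ, hδ0, hballsub, hbound, fun u hu => ?_, ?_⟩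
  · have := hmax' u (mem_ball_zero_iff.1 hu).le
    have h2 : (s - ‖u₀‖) = 2 * δ := by rw [hδ]; ring
    rw [h2] at this; linarith
  · have hmaps : MapsTo q (Metric.ball u₀ δ) (Metric.closedBall (q u₀) (3 * ‖q u₀‖)) :=
      fun u hu => by
        rw [Metric.mem_closedBall, dist_eq_norm]
        linarith [norm_sub_le (q u) (q u₀), hbound u hu]
    have hd : DifferentiableOn ℂ q (Metric.ball u₀ δ) :=
      hq.mono (hballsub.trans (Metric.ball_subset_ball hsr.le))
    -- By the Schwarz lemma `q` changes by at most `3/8 |q u₀|` on the disc of radius `δ/8`, so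
    -- `|q|` stays above half its central value. The resulting factor `π/256` exceeds `1/100`.
    have hlow : ∀ u ∈ Metric.ball u₀ (δ / 8), ‖q u₀‖ ^ 2 / 4 ≤ ‖q u‖ ^ 2 := fun u hu => by
      rw [Metric.mem_ball] at hu
      have h1 := Complex.dist_le_div_mul_dist_of_mapsTo_ball hd hmaps
        (Metric.mem_ball.2 (hu.trans (by linarith)))
      have h2 : 3 * ‖q u₀‖ / δ * dist u u₀ ≤ 3 * ‖q u₀‖ / δ * (δ / 8) :=
        mul_le_mul_of_nonneg_left hu.le (by positivity)
      have h3 : 3 * ‖q u₀‖ / δ * (δ / 8) = 3 / 8 * ‖q u₀‖ := by field_simp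
      rw [dist_eq_norm, norm_sub_rev] at h1
      have h4 := norm_sub_norm_le (q u₀) (q u)
      have h5 : ‖q u₀‖ / 2 ≤ ‖q u‖ := by linarith
      have := pow_le_pow_left₀ (by positivity) h5 2
      calc ‖q u₀‖ ^ 2 / 4 = (‖q u₀‖ / 2) ^ 2 := by ring
        _ ≤ _ := this
    calc ENNReal.ofReal ((δ * ‖q u₀‖) ^ 2 / 100)
        ≤ ENNReal.ofReal (‖q u₀‖ ^ 2 / 4) * volume (Metric.ball u₀ (δ / 8)) := by
          rw [Complex.volume_ball, ← ENNReal.ofReal_pow (by positivity), ← ENNReal.ofReal_coe_nnreal,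
            NNReal.coe_real_pi, ← ENNReal.ofReal_mul (by positivity),
            ← ENNReal.ofReal_mul (by positivity)]
          refine ENNReal.ofReal_le_ofReal ?_
          have := Real.pi_gt_three
          have h1 : ‖q u₀‖ ^ 2 / 4 * ((δ / 8) ^ 2 * Real.pi) =
            (δ * ‖q u₀‖) ^ 2 * (Real.pi / 256) := by ring
          rw [h1, div_eq_mul_inv]
          exact mul_le_mul_of_nonneg_left (by linarith) (sq_nonneg _)
      _ = ∫⁻ _ in Metric.ball u₀ (δ / 8), ENNReal.ofReal (‖q u₀‖ ^ 2 / 4) := by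
          rw [setLIntegral_const]
      _ ≤ ∫⁻ u in Metric.ball u₀ (δ / 8), ENNReal.ofReal (‖q u‖ ^ 2) :=
          setLIntegral_mono' measurableSet_ball fun u hu =>
            ENNReal.ofReal_le_ofReal (hlow u hu)
      _ ≤ _ := lintegral_mono_set (Metric.ball_subset_ball (by linarith))

/-- For a primitive `h` of `G'/G` with the right value at the centre, `G exp (-h)` has derivative
zero and equals `1`. -/
theorem exists_log_branch {G : ℂ → ℂ} {c : ℂ} {r : ℝ} (hr : 0 < r)
    (hG : DifferentiableOn ℂ G (Metric.ball c r)) (h0 : ∀ u ∈ Metric.ball c r, G u ≠ 0) :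
    ∃ h : ℂ → ℂ, ∀ u ∈ Metric.ball c r,
      HasDerivAt h (deriv G u / G u) u ∧ Complex.exp (h u) = G u := by
  have hc := Metric.mem_ball_self (x := c) hr
  have hq : DifferentiableOn ℂ (fun u => deriv G u / G u) (Metric.ball c r) :=
    (hG.deriv Metric.isOpen_ball).div hG h0
  obtain ⟨h, hhc, hh⟩ := hq.isExactOn_ball.with_val_at c (Complex.log (G c))
  have hGd : ∀ u ∈ Metric.ball c r, HasDerivAt G (deriv G u) u := fun u hu =>
    (hG.differentiableAt (Metric.isOpen_ball.mem_nhds hu)).hasDerivAt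
  have hder : ∀ u ∈ Metric.ball c r, HasDerivAt (fun u => G u * Complex.exp (-h u)) 0 u := by
    intro u hu
    have h1 := (hGd u hu).mul (hh u hu).neg.cexp
    have h2 : deriv G u * Complex.exp (-h u) +
      G u * (Complex.exp (-h u) * -(deriv G u / G u)) = 0 := by
        field_simp [h0 u hu]; ring
    have h3 : deriv G u * Complex.exp ((-h) u) +
      G u * (Complex.exp ((-h) u) * -(deriv G u / G u)) = 0 := h2
    rw [h3] at h1
    exact h1
  have hconst : ∀ u ∈ Metric.ball c r, G u * Complex.exp (-h u) = 1 := by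
    intro u hu
    have := (convex_ball c r).is_const_of_fderivWithin_eq_zero (𝕜 := ℂ)
      (f := fun u => G u * Complex.exp (-h u))
      (fun x hx => (hder x hx).differentiableAt.differentiableWithinAt)
      (fun x hx => by
        rw [fderivWithin_of_isOpen Metric.isOpen_ball hx]
        ext; simp [(hder x hx).deriv]) hu hc
    have h1 : G u * Complex.exp (-h u) = G c * Complex.exp (-h c) := this
    rw [h1, hhc, Complex.exp_neg, Complex.exp_log (h0 c hc), mul_inv_cancel₀ (h0 c hc)]
  refine ⟨h, fun u hu => ⟨hh u hu, ?_⟩⟩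
  have := hconst u hu
  rw [Complex.exp_neg] at this
  field_simp at this
  exact this.symm

/-- A branch of `log G` is `C`-Lipschitz, and its real part is `log |G|`. -/
theorem norm_mem_Icc_of_deriv_div_le {G : ℂ → ℂ} {c : ℂ} {r C : ℝ} (hC : 0 ≤ C)
    (hG : DifferentiableOn ℂ G (Metric.ball c r)) (h0 : ∀ u ∈ Metric.ball c r, G u ≠ 0)
    (hq : ∀ u ∈ Metric.ball c r, ‖deriv G u / G u‖ ≤ C) {u : ℂ} (hu : u ∈ Metric.ball c r) :
    Real.exp (-(C * r)) * ‖G c‖ ≤ ‖G u‖ ∧ ‖G u‖ ≤ Real.exp (C * r) * ‖G c‖ := by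
  have hr : 0 < r := Metric.nonempty_ball.1 ⟨u, hu⟩
  have hc := Metric.mem_ball_self (x := c) hr
  obtain ⟨h, hh⟩ := exists_log_branch hr hG h0
  have hlip : ‖h u - h c‖ ≤ C * ‖u - c‖ :=
    (convex_ball c r).norm_image_sub_le_of_norm_hasDerivWithin_le
      (fun x hx => (hh x hx).1.hasDerivWithinAt) hq hc hu
  have hur : ‖u - c‖ ≤ r := by
    have := Metric.mem_ball.1 hu; rw [dist_eq_norm] at this; exact this.le
  have hlip' : |(h u - h c).re| ≤ C * r :=
    (Complex.abs_re_le_norm _).trans (hlip.trans (mul_le_mul_of_nonneg_left hur hC))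
  rw [Complex.sub_re, abs_le] at hlip'
  have hnG : ∀ x ∈ Metric.ball c r, ‖G x‖ = Real.exp (h x).re := fun x hx => by
    rw [← (hh x hx).2, Complex.norm_exp]
  rw [hnG u hu, hnG c hc, ← Real.exp_add, ← Real.exp_add]
  exact ⟨Real.exp_le_exp.2 (by linarith), Real.exp_le_exp.2 (by linarith)⟩

/-- Distortion: an injective holomorphic function without zeros on a disc has logarithmic
derivative at most an absolute constant over the distance to the boundary. -/
theorem mul_norm_deriv_div_le {G : ℂ → ℂ} {r : ℝ}
    (hG : DifferentiableOn ℂ G (Metric.ball 0 r)) (h0 : ∀ u ∈ Metric.ball (0 : ℂ) r, G u ≠ 0)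
    (hinj : InjOn G (Metric.ball 0 r)) {u : ℂ} (hu : u ∈ Metric.ball (0 : ℂ) r) :
    (r - ‖u‖) * ‖deriv G u / G u‖ ≤ 8000 := by
  have hr : 0 < r := Metric.nonempty_ball.1 ⟨u, hu⟩
  have hq : DifferentiableOn ℂ (fun u => deriv G u / G u) (Metric.ball 0 r) :=
    (hG.deriv Metric.isOpen_ball).div hG h0
  have key : ∀ s, 0 < s → s < r → ∀ u ∈ Metric.ball (0 : ℂ) s,
      (s - ‖u‖) * ‖deriv G u / G u‖ ≤ 8000 := by
    intro s hs hsr u hu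
    obtain ⟨u₀, δ, hδ, hsub, hle, hmax, harea⟩ := exists_disc_almost_max hs hsr hq
    have hsub' : Metric.ball u₀ δ ⊆ Metric.ball 0 r := hsub.trans (Metric.ball_subset_ball hsr.le)
    set q₀ := ‖deriv G u₀ / G u₀‖ with hq₀
    set L := δ * q₀ with hL
    have hL0 : 0 ≤ L := mul_nonneg hδ.le (norm_nonneg _)
    have hu₀ : G u₀ ≠ 0 := h0 _ (hsub' (Metric.mem_ball_self hδ))
    have himage : G '' Metric.ball u₀ δ ⊆ {z : ℂ | Real.exp (Real.log ‖G u₀‖ - 2 * L) ≤ ‖z‖ ∧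
        ‖z‖ ≤ Real.exp (Real.log ‖G u₀‖ + 2 * L)} := by
      rintro _ ⟨v, hv, rfl⟩
      have := norm_mem_Icc_of_deriv_div_le (C := 2 * q₀) (by positivity) (hG.mono hsub')
        (fun x hx => h0 x (hsub' hx)) hle hv
      have h1 : 2 * q₀ * δ = 2 * L := by rw [hL]; ring
      rw [h1] at this
      refine ⟨?_, ?_⟩
      · rw [sub_eq_neg_add, Real.exp_add, Real.exp_log (norm_pos_iff.2 hu₀)]; exact this.1
      · rw [add_comm, Real.exp_add, Real.exp_log (norm_pos_iff.2 hu₀)]; exact this.2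
    -- The logarithmic area of the image is at least `L²/100`. The image lies in an annulus of
    -- logarithmic width `4L`, hence of area `8πL`, which bounds `L` absolutely.
    have hchain : ENNReal.ofReal (L ^ 2 / 100) ≤ ENNReal.ofReal (4 * L * (2 * Real.pi)) :=
      calc ENNReal.ofReal (L ^ 2 / 100)
          ≤ ∫⁻ u in Metric.ball u₀ δ, ENNReal.ofReal (‖deriv G u / G u‖ ^ 2) := harea
        _ = ∫⁻ z in G '' Metric.ball u₀ δ, logDensity z :=
          (setLIntegral_logDensity_image measurableSet_ball
            (fun x hx => hG.differentiableAt (Metric.isOpen_ball.mem_nhds (hsub' hx)))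
            (hinj.mono hsub') fun x hx => h0 x (hsub' hx)).symm
        _ ≤ _ := lintegral_mono_set himage
        _ ≤ _ := setLIntegral_logDensity_annulus_le _ _
        _ = _ := by congr 1; ring
    rw [ENNReal.ofReal_le_ofReal_iff (by positivity)] at hchain
    have hL4 : L ≤ 4000 := by
      by_contra hcon
      push Not at hcon
      nlinarith [Real.pi_lt_four]
    exact (hmax u hu).trans (by linarith)
  have hu' := mem_ball_zero_iff.1 hu
  have hlim : Tendsto (fun s : ℝ => (s - ‖u‖) * ‖deriv G u / G u‖) (𝓝[<] r)
      (𝓝 ((r - ‖u‖) * ‖deriv G u / G u‖)) := by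
    have : Continuous fun s : ℝ => (s - ‖u‖) * ‖deriv G u / G u‖ := by fun_prop
    exact (this.tendsto r).mono_left nhdsWithin_le_nhds
  refine le_of_tendsto hlim ?_
  filter_upwards [Ioo_mem_nhdsLT hu'] with s hs
  exact key s ((norm_nonneg u).trans_lt hs.1) hs.2 u (mem_ball_zero_iff.2 hs.1)

end MeroDyn

/-! ### Logarithmic derivatives of tract maps and their area sum. -/

namespace MeroDyn

open MeasureTheory

theorem inv_le_tractRadius {R : ℝ} (hR : 1 ≤ R) {m : ℕ} (hm : 0 < m) : R⁻¹ ≤ tractRadius R m := by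
  rw [tractRadius, ← Real.rpow_neg_one]
  refine Real.rpow_le_rpow_of_exponent_le hR (neg_le_neg ?_)
  rw [div_le_one (by positivity)]
  exact_mod_cast hm

variable {f : ℂ → ℂ} {R : ℝ} {a : ℂ} {G : ℂ → ℂ}

namespace IsTractMap

/-- This is what `|f 0| ≤ R` is for: `0` lies in no tract of a nonzero pole, so `G` has logarithms.
-/
theorem ne_zero (h : RegularAbove f R) (hG : IsTractMap f R a G) (ha : a ≠ 0) {u : ℂ}
    (hu : u ∈ Metric.ball (0 : ℂ) (tractRadius R (poleMultiplicity f a))) : G u ≠ 0 := by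
  intro h0
  by_cases hu0 : u = 0
  · rw [hu0, hG.map_zero] at h0; exact ha h0
  · have := (hG.mem_highSet u hu hu0).2
    rw [h0] at this
    exact absurd h.norm_zero_le (not_le.2 this)

theorem norm_deriv_div_le (h : RegularAbove f R) (hG : IsTractMap f R a G) (ha : a ≠ 0) {u : ℂ}
    (hu : u ∈ Metric.ball (0 : ℂ) (tractRadius R (poleMultiplicity f a) / 2)) :
    ‖deriv G u / G u‖ ≤ 16000 / tractRadius R (poleMultiplicity f a) := by
  have hr := tractRadius_pos (zero_lt_one.trans_le h.one_le) (poleMultiplicity f a)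
  set r := tractRadius R (poleMultiplicity f a)
  rw [mem_ball_zero_iff] at hu
  have h1 := mul_norm_deriv_div_le hG.differentiableOn (fun u hu => hG.ne_zero h ha hu) (hG.injOn h)
    (mem_ball_zero_iff.2 (hu.trans (by linarith)))
  have h2 : r / 2 * ‖deriv G u / G u‖ ≤ (r - ‖u‖) * ‖deriv G u / G u‖ :=
    mul_le_mul_of_nonneg_right (by linarith) (norm_nonneg _)
  rw [le_div_iff₀ hr]
  linarith

theorem half_ball_subset (h : RegularAbove f R) :
    Metric.ball (0 : ℂ) (tractRadius R (poleMultiplicity f a) / 2) ⊆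
      Metric.ball 0 (tractRadius R (poleMultiplicity f a)) :=
  Metric.ball_subset_ball
    (half_le_self (tractRadius_pos (zero_lt_one.trans_le h.one_le) _).le)

theorem norm_mem_Icc (h : RegularAbove f R) (hG : IsTractMap f R a G) (ha : a ≠ 0) {u : ℂ}
    (hu : u ∈ Metric.ball (0 : ℂ) (tractRadius R (poleMultiplicity f a) / 2)) :
    Real.exp (-8000) * ‖a‖ ≤ ‖G u‖ ∧ ‖G u‖ ≤ Real.exp 8000 * ‖a‖ := by
  have hr := tractRadius_pos (zero_lt_one.trans_le h.one_le) (poleMultiplicity f a)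
  have hsub := half_ball_subset (a := a) h
  set r := tractRadius R (poleMultiplicity f a)
  have := norm_mem_Icc_of_deriv_div_le (C := 16000 / r) (by positivity)
    (hG.differentiableOn.mono hsub) (fun x hx => hG.ne_zero h ha (hsub hx))
    (fun x hx => hG.norm_deriv_div_le h ha hx) hu
  have h1 : 16000 / r * (r / 2) = 8000 := by field_simp; norm_num
  rwa [h1, hG.map_zero] at this

/-- On a quarter of the disc, the logarithmic derivative of a tract map is bounded in terms of the
logarithmic area of the tract. -/
theorem exists_bound_deriv_div (h : RegularAbove f R) (hG : IsTractMap f R a G) (ha : a ≠ 0) :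
    ∃ β : ℝ, 0 ≤ β ∧
      (∀ u ∈ Metric.ball (0 : ℂ) (tractRadius R (poleMultiplicity f a) / 4),
        ‖deriv G u / G u‖ ≤ β) ∧
      ENNReal.ofReal (β ^ 2) ≤ ENNReal.ofReal (6400 * R ^ 2) *
        ∫⁻ z in G '' Metric.ball 0 (tractRadius R (poleMultiplicity f a) / 2), logDensity z := by
  have hR : 0 < R := zero_lt_one.trans_le h.one_le
  have hr := tractRadius_pos hR (poleMultiplicity f a)
  have hrR := inv_le_tractRadius h.one_le (hG.poleMultiplicity_pos h)
  have hsub := half_ball_subset (a := a) h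
  set r := tractRadius R (poleMultiplicity f a)
  have hq : DifferentiableOn ℂ (fun u => deriv G u / G u) (Metric.ball 0 r) :=
    (hG.differentiableOn.deriv Metric.isOpen_ball).div hG.differentiableOn
      fun u hu => hG.ne_zero h ha hu
  obtain ⟨u₀, δ, hδ, hball, -, hmax, harea⟩ :=
    exists_disc_almost_max (half_pos hr) (half_lt_self hr) hq
  set L := δ * ‖deriv G u₀ / G u₀‖ with hL
  have hL0 : 0 ≤ L := by positivity
  -- On the quarter disc `r/2 - |u| ≥ r/4`, so the almost-maximum bound `2L` yields `8L/r`. Together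
  -- with `1/r ≤ R`, valid for every multiplicity, the area bound yields the factor `6400 R²`.
  refine ⟨8 * L / r, by positivity, fun u hu => ?_, ?_⟩
  · rw [mem_ball_zero_iff] at hu
    have h1 := hmax u (mem_ball_zero_iff.2 (by linarith))
    have h2 : r / 4 * ‖deriv G u / G u‖ ≤ (r / 2 - ‖u‖) * ‖deriv G u / G u‖ :=
      mul_le_mul_of_nonneg_right (by linarith) (norm_nonneg _)
    rw [le_div_iff₀ hr]
    linarith
  · have hRr : 1 / r ≤ R := by
      rw [one_div]; exact inv_le_of_inv_le₀ hR hrR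
    calc ENNReal.ofReal ((8 * L / r) ^ 2)
        ≤ ENNReal.ofReal (6400 * R ^ 2 * (L ^ 2 / 100)) := by
          refine ENNReal.ofReal_le_ofReal ?_
          have h1 : (8 * L / r) ^ 2 = 64 * L ^ 2 * (1 / r) ^ 2 := by ring
          have h2 : (1 / r) ^ 2 ≤ R ^ 2 := pow_le_pow_left₀ (by positivity) hRr 2
          rw [h1]
          nlinarith [mul_le_mul_of_nonneg_left h2 (sq_nonneg L)]
      _ = ENNReal.ofReal (6400 * R ^ 2) * ENNReal.ofReal (L ^ 2 / 100) :=
          ENNReal.ofReal_mul (by positivity)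
      _ ≤ ENNReal.ofReal (6400 * R ^ 2) *
          ∫⁻ u in Metric.ball 0 (r / 2), ENNReal.ofReal (‖deriv G u / G u‖ ^ 2) := by
          gcongr
          exact harea.trans (lintegral_mono_set hball)
      _ = _ := by
          rw [setLIntegral_logDensity_image measurableSet_ball
            (fun x hx => hG.differentiableOn.differentiableAt
              (Metric.isOpen_ball.mem_nhds (hsub hx)))
            ((hG.injOn h).mono hsub) fun x hx => hG.ne_zero h ha (hsub hx)]

end IsTractMap

theorem countable_setOf_isPole (hf : MeromorphicNFOn f univ) : {z | IsPole f z}.Countable := by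
  have hm : Meromorphic f := fun z => meromorphicAt_of_nf hf z
  refine Set.Countable.mono (fun z (hz : IsPole f z) => ?_) hm.countable_compl_analyticAt
  exact fun hcon => not_isPole_of_analyticAt hcon hz

/-- The integrand is `|z|^(-2-ε)`, integrable at infinity in real dimension two. -/
theorem setLIntegral_rpow_mul_logDensity_lt_top {ε : ℝ} (hε : 0 < ε) :
    ∫⁻ z in {z : ℂ | 1 ≤ ‖z‖}, ENNReal.ofReal (‖z‖ ^ (-ε)) * logDensity z < ⊤ := by
  have hfin := finite_integral_one_add_norm (E := ℂ) (μ := volume) (r := 2 + ε)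
    (by rw [Complex.finrank_real_complex]; push_cast; linarith)
  calc ∫⁻ z in {z : ℂ | 1 ≤ ‖z‖}, ENNReal.ofReal (‖z‖ ^ (-ε)) * logDensity z
      ≤ ∫⁻ z in {z : ℂ | 1 ≤ ‖z‖}, ENNReal.ofReal (2 ^ (2 + ε)) *
          ENNReal.ofReal ((1 + ‖z‖) ^ (-(2 + ε))) := by
        refine setLIntegral_mono' (measurableSet_le measurable_const measurable_norm) fun z hz => ?_
        have hz1 : (1 : ℝ) ≤ ‖z‖ := hz
        have hz0 : 0 < ‖z‖ := zero_lt_one.trans_le hz1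
        rw [logDensity, ← ENNReal.ofReal_inv_of_pos (by positivity),
          ← ENNReal.ofReal_mul (by positivity), ← ENNReal.ofReal_mul (by positivity)]
        refine ENNReal.ofReal_le_ofReal ?_
        have h1 : ‖z‖ ^ (-ε) * (‖z‖ ^ 2)⁻¹ = ‖z‖ ^ (-(2 + ε)) := by
          rw [← Real.rpow_natCast, ← Real.rpow_neg hz0.le, ← Real.rpow_add hz0]
          congr 1; push_cast; ring
        have h2 : (2 : ℝ) ^ (2 + ε) * (1 + ‖z‖) ^ (-(2 + ε)) = ((1 + ‖z‖) / 2) ^ (-(2 + ε)) := by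
          rw [Real.div_rpow (by positivity) (by norm_num), Real.rpow_neg (by norm_num : (0:ℝ) ≤ 2),
            div_inv_eq_mul, mul_comm]
        rw [h1, h2]
        exact Real.rpow_le_rpow_of_nonpos (by positivity) (by linarith) (by linarith)
    _ ≤ ∫⁻ z : ℂ, ENNReal.ofReal (2 ^ (2 + ε)) * ENNReal.ofReal ((1 + ‖z‖) ^ (-(2 + ε))) :=
        setLIntegral_le_lintegral _ _
    _ = ENNReal.ofReal (2 ^ (2 + ε)) * ∫⁻ z : ℂ, ENNReal.ofReal ((1 + ‖z‖) ^ (-(2 + ε))) :=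
        lintegral_const_mul' _ _ ENNReal.ofReal_ne_top
    _ < ⊤ := ENNReal.mul_lt_top ENNReal.ofReal_lt_top hfin

/-- Area estimate: the sum over the poles of the squares of the logarithmic derivatives converges
with any negative power of the modulus of the pole as weight. -/
theorem RegularAbove.exists_deriv_bounds (h : RegularAbove f R) {T : ℂ → ℂ → ℂ}
    (hT : ∀ a, IsPole f a → IsTractMap f R a (T a)) :
    ∃ β : ℂ → ℝ, (∀ a, IsPole f a → a ≠ 0 → 0 ≤ β a ∧
        ∀ u ∈ Metric.ball (0 : ℂ) (tractRadius R (poleMultiplicity f a) / 4),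
          ‖deriv (T a) u / T a u‖ ≤ β a) ∧
      ∀ ε : ℝ, 0 < ε → ∑' a : {a : ℂ // IsPole f a ∧ Real.exp 8000 ≤ ‖a‖},
        ENNReal.ofReal (β a ^ 2 * ‖(a : ℂ)‖ ^ (-ε)) ≠ ⊤ := by
  have hex : ∀ a, IsPole f a → a ≠ 0 → _ := fun a ha ha0 => (hT a ha).exists_bound_deriv_div h ha0
  choose! β hβ0 hβ hβarea using hex
  refine ⟨β, fun a ha ha0 => ⟨hβ0 a ha ha0, hβ a ha ha0⟩, fun ε hε => ?_⟩
  set P := {a : ℂ // IsPole f a ∧ Real.exp 8000 ≤ ‖a‖}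
  have hcount : Countable P :=
    ((countable_setOf_isPole h.nf).mono (fun a (ha : IsPole f a ∧ _) => ha.1)).to_subtype
  have hne : ∀ a : P, (a : ℂ) ≠ 0 := fun a => norm_pos_iff.1 ((Real.exp_pos _).trans_le a.2.2)
  set B : P → Set ℂ := fun a =>
    T a '' Metric.ball 0 (tractRadius R (poleMultiplicity f a) / 2) with hB
  have hsub : ∀ a : P, _ := fun a => IsTractMap.half_ball_subset (a := (a : ℂ)) h
  have hBm : ∀ a, MeasurableSet (B a) := fun a =>
    measurableSet_ball.image_of_continuousOn_injOn
      ((hT a a.2.1).differentiableOn.continuousOn.mono (hsub a)) (((hT a a.2.1).injOn h).mono (hsub a))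
  have hBd : Pairwise (Function.onFun Disjoint B) := by
    intro a b hab
    rw [Function.onFun, Set.disjoint_left]
    rintro _ ⟨u, hu, rfl⟩ ⟨v, hv, hvu⟩
    exact hab (Subtype.ext ((hT a a.2.1).eq_of_apply_eq h (hT b b.2.1)
      (mem_ball_zero_iff.1 (hsub a hu)) (mem_ball_zero_iff.1 (hsub b hv)) hvu.symm))
  -- The threshold `exp 8000` is the distortion constant: the half tracts then stay in `{|z| ≥ 1}`,
  -- where the weighted area is finite.
  have hB1 : ∀ a, B a ⊆ {z : ℂ | 1 ≤ ‖z‖} := by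
    rintro a _ ⟨u, hu, rfl⟩
    refine le_trans ?_ ((hT a a.2.1).norm_mem_Icc h (hne a) hu).1
    rw [Real.exp_neg, ← div_eq_inv_mul, one_le_div (Real.exp_pos _)]
    exact a.2.2
  set w : ℂ → ENNReal := fun z => ENNReal.ofReal (‖z‖ ^ (-ε)) * logDensity z with hw
  set C : ENNReal := ENNReal.ofReal (6400 * R ^ 2) * ENNReal.ofReal (Real.exp 8000 ^ ε) with hC
  have hterm : ∀ a : P, ENNReal.ofReal (β a ^ 2 * ‖(a : ℂ)‖ ^ (-ε)) ≤ C * ∫⁻ z in B a, w z := by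
    intro a
    have ha0 : 0 < ‖(a : ℂ)‖ := norm_pos_iff.2 (hne a)
    calc ENNReal.ofReal (β a ^ 2 * ‖(a : ℂ)‖ ^ (-ε))
        = ENNReal.ofReal (β a ^ 2) * ENNReal.ofReal (‖(a : ℂ)‖ ^ (-ε)) :=
          ENNReal.ofReal_mul (by positivity)
      _ ≤ ENNReal.ofReal (6400 * R ^ 2) * (∫⁻ z in B a, logDensity z) *
          ENNReal.ofReal (‖(a : ℂ)‖ ^ (-ε)) := by
          gcongr; exact hβarea a a.2.1 (hne a)
      _ = ENNReal.ofReal (6400 * R ^ 2) *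
          ∫⁻ z in B a, ENNReal.ofReal (‖(a : ℂ)‖ ^ (-ε)) * logDensity z := by
          rw [lintegral_const_mul' _ _ ENNReal.ofReal_ne_top]; ring
      _ ≤ ENNReal.ofReal (6400 * R ^ 2) *
          ∫⁻ z in B a, ENNReal.ofReal (Real.exp 8000 ^ ε) * w z := by
          refine mul_le_mul' le_rfl ?_
          refine setLIntegral_mono' (hBm a) fun z hz => ?_
          obtain ⟨u, hu, rfl⟩ := hz
          have hz0 : 0 < ‖T a u‖ := zero_lt_one.trans_le (hB1 a ⟨u, hu, rfl⟩)
          rw [hw, ← mul_assoc, ← ENNReal.ofReal_mul (by positivity)]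
          gcongr ENNReal.ofReal ?_ * _
          have hle := ((hT a a.2.1).norm_mem_Icc h (hne a) hu).2
          have h1 : Real.exp 8000 ^ ε * ‖T a u‖ ^ (-ε) = (‖T a u‖ / Real.exp 8000) ^ (-ε) := by
            rw [Real.div_rpow (by positivity) (by positivity), Real.rpow_neg (Real.exp_pos _).le,
              div_inv_eq_mul, mul_comm]
          rw [h1]
          refine Real.rpow_le_rpow_of_nonpos (by positivity) ?_ (by linarith)
          rw [div_le_iff₀ (Real.exp_pos _)]; linarith
      _ = C * ∫⁻ z in B a, w z := by
          rw [lintegral_const_mul' _ _ ENNReal.ofReal_ne_top, hC]; ring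
  refine ne_top_of_le_ne_top ?_ (ENNReal.tsum_le_tsum hterm)
  rw [ENNReal.tsum_mul_left, ← lintegral_iUnion hBm hBd]
  refine ENNReal.mul_ne_top (ENNReal.mul_ne_top ENNReal.ofReal_ne_top ENNReal.ofReal_ne_top) ?_
  exact ((lintegral_mono_set (iUnion_subset hB1)).trans_lt
    (setLIntegral_rpow_mul_logDensity_lt_top hε)).ne

end MeroDyn

/-! ### Counting poles and summing the contraction coefficients. -/

namespace MeroDyn
open MeasureTheory

variable {f : ℂ → ℂ} {R : ℝ}

/-- If the number of points of `P` in the disc of radius `x` is `O(x ^ s)`, then the exponent of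
convergence of `P` is at most `s`. -/
theorem tsum_rpow_ne_top_of_card_le {P : Set ℂ} {C s σ : ℝ} (hσ : 0 < σ) (hsσ : s < σ)
    (hP1 : ∀ a ∈ P, 1 ≤ ‖a‖)
    (hcard : ∀ x : ℝ, 1 ≤ x → ∀ F : Finset ℂ, (∀ a ∈ F, a ∈ P ∧ ‖a‖ ≤ x) → (F.card : ℝ) ≤ C * x ^ s) :
    ∑' a : P, ENNReal.ofReal (‖(a : ℂ)‖ ^ (-σ)) ≠ ⊤ := by
  classical
  set e : ℕ → ℝ := fun k => Real.exp k with he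
  have he1 : ∀ k, 1 ≤ e k := fun k => Real.one_le_exp (Nat.cast_nonneg k)
  -- Each term is dominated by its level `k = ⌈log |a|⌉`; by the counting bound, level `k`
  -- contributes at most a constant times `exp (s - σ)^k`, which is geometrically summable.
  set g : ℕ → P → ENNReal := fun k a =>
    if ‖(a : ℂ)‖ ≤ e k then ENNReal.ofReal (Real.exp σ * e k ^ (-σ)) else 0 with hg
  have hle : ∀ a : P, ENNReal.ofReal (‖(a : ℂ)‖ ^ (-σ)) ≤ ∑' k, g k a := by
    intro a
    have ha1 := hP1 a a.2
    have ha0 : 0 < ‖(a : ℂ)‖ := zero_lt_one.trans_le ha1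
    have hlog : 0 ≤ Real.log ‖(a : ℂ)‖ := Real.log_nonneg ha1
    refine le_trans ?_ (ENNReal.le_tsum ⌈Real.log ‖(a : ℂ)‖⌉₊)
    have h1 : ‖(a : ℂ)‖ ≤ e ⌈Real.log ‖(a : ℂ)‖⌉₊ := by
      rw [he, ← Real.log_le_iff_le_exp ha0]; exact Nat.le_ceil _
    have h2 : e ⌈Real.log ‖(a : ℂ)‖⌉₊ ≤ Real.exp 1 * ‖(a : ℂ)‖ := by
      have := (Nat.ceil_lt_add_one hlog).le
      calc e ⌈Real.log ‖(a : ℂ)‖⌉₊ ≤ Real.exp (Real.log ‖(a : ℂ)‖ + 1) := Real.exp_le_exp.2 this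
        _ = _ := by rw [Real.exp_add, Real.exp_log ha0, mul_comm]
    simp only [hg, if_pos h1]
    refine ENNReal.ofReal_le_ofReal ?_
    have h3 : Real.exp σ * (Real.exp 1 * ‖(a : ℂ)‖) ^ (-σ) = ‖(a : ℂ)‖ ^ (-σ) := by
      rw [Real.mul_rpow (Real.exp_pos _).le ha0.le, ← mul_assoc, ← Real.exp_mul, ← Real.exp_add]
      simp
    rw [← h3]
    exact mul_le_mul_of_nonneg_left (Real.rpow_le_rpow_of_nonpos
      (zero_lt_one.trans_le (he1 _)) h2 (by linarith)) (Real.exp_pos _).le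
  have hgk : ∀ k, ∑' a, g k a ≤ ENNReal.ofReal (C * Real.exp σ * Real.exp (s - σ) ^ k) := by
    intro k
    rw [ENNReal.tsum_eq_iSup_sum]
    refine iSup_le fun F => ?_
    simp only [hg]
    rw [← Finset.sum_filter, Finset.sum_const, nsmul_eq_mul]
    set F' := ((F.filter fun a : P => ‖(a : ℂ)‖ ≤ e k).map (Function.Embedding.subtype _)) with hF'
    have hc := hcard (e k) (he1 k) F' (by
      intro a ha
      rw [hF', Finset.mem_map] at ha
      obtain ⟨b, hb, rfl⟩ := ha
      exact ⟨b.2, (Finset.mem_filter.1 hb).2⟩)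
    rw [hF', Finset.card_map] at hc
    rw [← ENNReal.ofReal_natCast, ← ENNReal.ofReal_mul (Nat.cast_nonneg _)]
    refine ENNReal.ofReal_le_ofReal ?_
    have hek : 0 < e k := zero_lt_one.trans_le (he1 k)
    calc _ ≤ (C * e k ^ s) * (Real.exp σ * e k ^ (-σ)) :=
          mul_le_mul_of_nonneg_right hc (by positivity)
      _ = C * Real.exp σ * (e k ^ s * e k ^ (-σ)) := by ring
      _ = C * Real.exp σ * Real.exp (s - σ) ^ k := by
          rw [← Real.rpow_add hek, he, ← Real.exp_mul, ← Real.exp_nat_mul]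
          congr 2
  have hq : Real.exp (s - σ) < 1 := by
    rw [← Real.exp_zero]; exact Real.exp_lt_exp.2 (by linarith)
  have hsum : Summable fun k : ℕ => C * Real.exp σ * Real.exp (s - σ) ^ k :=
    (summable_geometric_of_lt_one (Real.exp_pos _).le hq).mul_left _
  refine ne_top_of_le_ne_top ?_ (ENNReal.tsum_le_tsum hle)
  rw [ENNReal.tsum_comm]
  refine ne_top_of_le_ne_top ?_ (ENNReal.tsum_le_tsum hgk)
  exact hsum.tsum_ofReal_ne_top

/-- The pole divisor dominates the sum of simple points over `F`, logarithmic counting functions are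
monotone in the divisor for `r ≥ 1`, and the proximity function is nonnegative. -/
theorem sum_log_le_characteristic (hf : MeromorphicNFOn f univ) {F : Finset ℂ} {r : ℝ} (hr : 1 ≤ r)
    (hF : ∀ a ∈ F, IsPole f a ∧ ‖a‖ ≤ r) :
    ∑ a ∈ F, (Real.log r - Real.log ‖a‖) ≤ ValueDistribution.characteristic f ⊤ r := by
  classical
  have hm : MeromorphicOn f univ := fun z _ => meromorphicAt_of_nf hf z
  set D := (MeromorphicOn.divisor f univ)⁻ with hD
  set D₀ : Function.locallyFinsupp ℂ ℤ := ∑ a ∈ F, Function.locallyFinsuppWithin.single a 1 with hD₀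
  have hle : D₀ ≤ D := by
    intro z
    have h1 : D₀ z = if z ∈ F then 1 else 0 := by
      rw [hD₀, Function.locallyFinsuppWithin.coe_sum, Finset.sum_apply]
      simp [Function.locallyFinsuppWithin.single_apply]
    rw [h1, hD, Function.locallyFinsuppWithin.negPart_apply,
      MeromorphicOn.divisor_apply hm (mem_univ z)]
    split_ifs with hz
    · have hneg : meromorphicOrderAt f z < 0 := (hF z hz).1
      have hne : meromorphicOrderAt f z ≠ ⊤ := fun h => by rw [h] at hneg; exact not_top_lt hneg
      obtain ⟨n, hn⟩ := WithTop.ne_top_iff_exists.1 hne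
      rw [← hn] at hneg ⊢
      have hn0 : n < 0 := by exact_mod_cast hneg
      rw [WithTop.untop₀_coe, negPart_def]
      have h1n : (1 : ℤ) ≤ -n := by omega
      exact le_sup_of_le_left h1n
    · exact negPart_nonneg _
  have h1 := Function.locallyFinsuppWithin.logCounting_le hle hr
  have h2 : Function.locallyFinsuppWithin.logCounting D₀ r =
      ∑ a ∈ F, (Real.log r - Real.log ‖a‖) := by
    rw [hD₀, map_sum, Finset.sum_apply]
    refine Finset.sum_congr rfl fun a ha => ?_
    rw [Function.locallyFinsuppWithin.logCounting_single_eq_log_sub_const (hF a ha).2]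
    simp
  rw [h2, hD] at h1
  rw [ValueDistribution.characteristic, Pi.add_apply, ValueDistribution.logCounting_top]
  have h3 : 0 ≤ ValueDistribution.proximity f ⊤ r := ValueDistribution.proximity_nonneg r
  exact h1.trans (le_add_of_nonneg_left h3)

theorem eventually_characteristic_le_rpow {s : ℝ} (hs : order f < s) :
    ∀ᶠ r : ℝ in atTop, ValueDistribution.characteristic f ⊤ r ≤ r ^ s := by
  have := eventually_lt_of_limsup_lt hs
  filter_upwards [this, eventually_gt_atTop 1] with r hr hr1
  have hr0 : 0 < r := zero_lt_one.trans hr1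
  have hlog : 0 < Real.log r := Real.log_pos hr1
  rcases le_or_gt (ValueDistribution.characteristic f ⊤ r) 0 with hT | hT
  · exact hT.trans (by positivity)
  · have h1 : Real.log (ValueDistribution.characteristic f ⊤ r) / Real.log r < s := by
      exact_mod_cast hr
    rw [div_lt_iff₀ hlog] at h1
    rw [← Real.log_le_log_iff hT (by positivity), Real.log_rpow hr0]
    exact h1.le

/-- A pole forces `T(r, f) ≥ log r - log |a|`, which is unbounded, whereas negative order would give
`T(r, f) ≤ 1` for large `r`. -/
theorem order_nonneg_of_isPole (hf : MeromorphicNFOn f univ) {ρ : ℝ} (hρ : order f = (ρ : EReal))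
    {a : ℂ} (ha : IsPole f a) : 0 ≤ ρ := by
  by_contra hneg
  push Not at hneg
  have h1 := eventually_characteristic_le_rpow (f := f) (s := 0) (by rw [hρ]; exact_mod_cast hneg)
  have h2 : Tendsto (fun r : ℝ => Real.log r - Real.log ‖a‖) atTop atTop :=
    tendsto_atTop_add_const_right _ _ Real.tendsto_log_atTop
  obtain ⟨r, h1, h2, hr, har⟩ := (h1.and ((h2.eventually_gt_atTop 1).and
    ((eventually_ge_atTop 1).and (eventually_ge_atTop ‖a‖)))).exists
  have := sum_log_le_characteristic hf (F := {a}) hr (by simpa using ⟨ha, har⟩)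
  rw [Finset.sum_singleton] at this
  rw [Real.rpow_zero] at h1
  linarith

/-- The exponent of convergence of the poles is at most the order. -/
theorem tsum_poles_rpow_ne_top (hf : MeromorphicNFOn f univ) {ρ σ : ℝ}
    (hρ : order f = (ρ : EReal)) (hσ0 : 0 < σ) (hσ : ρ < σ) {P : Set ℂ}
    (hP : ∀ a ∈ P, IsPole f a ∧ 1 ≤ ‖a‖) :
    ∑' a : P, ENNReal.ofReal (‖(a : ℂ)‖ ^ (-σ)) ≠ ⊤ := by
  obtain ⟨s, hρs, hsσ⟩ := exists_between hσ
  obtain ⟨r₀, hr₀⟩ := eventually_atTop.1 (eventually_characteristic_le_rpow (f := f) (s := s)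
    (by rw [hρ]; exact_mod_cast hρs))
  set x₁ := max r₀ 1
  have hx₁ : 1 ≤ x₁ := le_max_right _ _
  refine tsum_rpow_ne_top_of_card_le (C := (Real.exp 1 * x₁) ^ s) hσ0 hsσ
    (fun a ha => (hP a ha).2) fun x hx F hF => ?_
  have hx0 : 0 < x := zero_lt_one.trans_le hx
  have he : 1 ≤ Real.exp 1 := Real.one_le_exp zero_le_one
  -- The factor `exp 1` makes each pole of modulus at most `x` contribute at least `1`; the factor
  -- `x₁` makes the growth bound apply already from `x = 1`.
  set r := Real.exp 1 * x₁ * x with hr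
  have hxr : Real.exp 1 * x ≤ r := by
    rw [hr, mul_right_comm]; exact le_mul_of_one_le_right (by positivity) hx₁
  have hx₁r : x₁ ≤ r := by
    calc x₁ = 1 * x₁ * 1 := by ring
      _ ≤ r := by rw [hr]; gcongr
  have h1 := sum_log_le_characteristic hf (F := F) (r := r) (hx₁.trans hx₁r) fun a ha =>
    ⟨(hP a (hF a ha).1).1, (hF a ha).2.trans (le_trans (by nlinarith) hxr)⟩
  have h2 : (F.card : ℝ) ≤ ∑ a ∈ F, (Real.log r - Real.log ‖a‖) := by
    have : ∀ a ∈ F, (1 : ℝ) ≤ Real.log r - Real.log ‖a‖ := fun a ha => by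
      have ha1 := (hP a (hF a ha).1).2
      have h3 : Real.exp 1 * ‖a‖ ≤ r := le_trans (by gcongr; exact (hF a ha).2) hxr
      have h4 := Real.log_le_log (by positivity) h3
      rw [Real.log_mul (Real.exp_pos _).ne' (by positivity), Real.log_exp] at h4
      linarith
    simpa using Finset.card_nsmul_le_sum F _ 1 this
  have h3 := hr₀ r ((le_max_left _ _).trans hx₁r)
  have h4 : r ^ s = (Real.exp 1 * x₁) ^ s * x ^ s := Real.mul_rpow (by positivity) hx0.le
  linarith

/-- The contraction coefficients of the inverse branches are `t`-summable for
`t > 2 M ρ / (2 + M ρ)`. -/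
theorem tsum_contraction_ne_top (hf : MeromorphicNFOn f univ) {ρ t : ℝ}
    (hρ : order f = (ρ : EReal)) (hρ0 : 0 ≤ ρ) {M : ℕ} (hM : 1 ≤ M)
    (ht : 2 * M * ρ / (2 + M * ρ) < t) (ht2 : t < 2) {P : Set ℂ} {β : ℂ → ℝ}
    (hP : ∀ a ∈ P, IsPole f a ∧ 1 ≤ ‖a‖) (hβ0 : ∀ a ∈ P, 0 ≤ β a)
    (hβ : ∀ ε : ℝ, 0 < ε → ∑' a : P, ENNReal.ofReal (β a ^ 2 * ‖(a : ℂ)‖ ^ (-ε)) ≠ ⊤) :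
    ∑' a : P, ENNReal.ofReal ((‖(a : ℂ)‖ ^ (-(1 / (M : ℝ))) * β a) ^ t) ≠ ⊤ := by
  have hM0 : (0 : ℝ) < M := by exact_mod_cast hM
  have hden : 0 < 2 + M * ρ := by positivity
  have ht0 : 0 < t := lt_of_le_of_lt (by positivity) ht
  -- The gap is positive exactly when `t (2 + Mρ) > 2Mρ`; this is where the bound of the theorem
  -- arises.
  have hgap : 0 < t / M - ρ * (1 - t / 2) := by
    rw [div_lt_iff₀ hden] at ht
    have : t / M - ρ * (1 - t / 2) = (t * (2 + M * ρ) - 2 * M * ρ) / (2 * M) := by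
      field_simp; ring
    rw [this]
    exact div_pos (by linarith) (by positivity)
  set g := t / M - ρ * (1 - t / 2) with hg
  have ht2' : 0 < 1 - t / 2 := by linarith
  -- The exponents share the gap equally: `ε t/2 = g/2` and `σ (1 - t/2) = ρ (1 - t/2) + g/2`. They
  -- add up to `t/M`, and `σ > ρ`.
  set ε := g / t with hε
  have hε0 : 0 < ε := div_pos hgap ht0
  set σ := (t / M - g / 2) / (1 - t / 2) with hσ
  have hσρ : ρ < σ := by
    rw [hσ, lt_div_iff₀ ht2']; linarith
  have hσ0 : 0 < σ := lt_of_le_of_lt hρ0 hσρ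
  have hsum := ENNReal.add_ne_top.2 ⟨hβ ε hε0, tsum_poles_rpow_ne_top hf hρ hσ0 hσρ hP⟩
  rw [← ENNReal.tsum_add] at hsum
  refine ne_top_of_le_ne_top hsum (ENNReal.tsum_le_tsum fun a => ?_)
  have ha0 : 0 < ‖(a : ℂ)‖ := zero_lt_one.trans_le (hP a a.2).2
  have hb := hβ0 a a.2
  rw [← ENNReal.ofReal_add (by positivity) (by positivity)]
  refine ENNReal.ofReal_le_ofReal ?_
  have hY := Real.geom_mean_le_arith_mean2_weighted (w₁ := t / 2) (w₂ := 1 - t / 2)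
    (p₁ := β a ^ 2 * ‖(a : ℂ)‖ ^ (-ε)) (p₂ := ‖(a : ℂ)‖ ^ (-σ)) (by positivity) ht2'.le
    (by positivity) (by positivity) (by ring)
  have h1 : (‖(a : ℂ)‖ ^ (-(1 / (M : ℝ))) * β a) ^ t =
      (β a ^ 2 * ‖(a : ℂ)‖ ^ (-ε)) ^ (t / 2) * (‖(a : ℂ)‖ ^ (-σ)) ^ (1 - t / 2) := by
    rw [Real.mul_rpow (by positivity) hb, Real.mul_rpow (by positivity) (by positivity),
      ← Real.rpow_natCast, ← Real.rpow_mul hb, ← Real.rpow_mul ha0.le, ← Real.rpow_mul ha0.le,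
      ← Real.rpow_mul ha0.le, mul_assoc, ← Real.rpow_add ha0]
    have e1 : ((2 : ℕ) : ℝ) * (t / 2) = t := by push_cast; ring
    have e2 : -ε * (t / 2) + -σ * (1 - t / 2) = -(1 / (M : ℝ)) * t := by
      have e3 : ε * t = g := div_mul_cancel₀ _ ht0.ne'
      have e4 : σ * (1 - t / 2) = t / M - g / 2 := div_mul_cancel₀ _ ht2'.ne'
      have e5 : 1 / (M : ℝ) * t = t / M := by ring
      linarith
    rw [e1, e2, mul_comm]
  rw [h1]
  refine hY.trans (add_le_add ?_ ?_)
  · exact mul_le_of_le_one_left (by positivity) (by linarith)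
  · exact mul_le_of_le_one_left (by positivity) (by linarith)

end MeroDyn

/-! ### Graph-directed contractions and inverse branches. -/

namespace MeroDyn
open MeasureTheory

/-- Upper bound for the dimension of the limit sets of a countable graph-directed system of
contractions. -/
theorem dimH_le_of_contractions {E ι J : Type} [MetricSpace E] [Countable J] (src : J → ι)
    (X : ι → Set E) (φ : ι → J → E → E) (lam : J → NNReal) {D : ENNReal} (hD : D ≠ ⊤)
    (hX : ∀ a, Metric.ediam (X a) ≤ D) (hcov : ∀ a, X a ⊆ ⋃ j, φ a j '' X (src j))
    (hlip : ∀ a j, LipschitzOnWith (lam j) (φ a j) (X (src j))) {t : NNReal} (ht : 0 < t)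
    (hsum : ∑' j, (lam j : ENNReal) ^ (t : ℝ) ≤ 2⁻¹) (a : ι) : dimH (X a) ≤ t := by
  borelize E
  have ht0 : (0 : ℝ) < t := ht
  -- Covers of generation `n` have total `t`-mass at most `D^t 2^(-n)`, so the `t`-dimensional
  -- Hausdorff measure vanishes.
  have key : ∀ n : ℕ, ∀ a, ∃ (I : Type) (_ : Countable I) (c : I → Set E), X a ⊆ ⋃ i, c i ∧
      (∀ i, c i ⊆ X a) ∧ ∑' i, Metric.ediam (c i) ^ (t : ℝ) ≤ D ^ (t : ℝ) * 2⁻¹ ^ n := by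
    intro n
    induction n with
    | zero =>
      intro a
      refine ⟨Unit, inferInstance, fun _ => X a, subset_iUnion (fun _ : Unit => X a) (),
        fun _ => subset_rfl, ?_⟩
      simpa using ENNReal.rpow_le_rpow (hX a) ht0.le
    | succ n ih =>
      intro a
      choose I hI c hc hcX hcs using ih
      -- Intersecting with `X a` keeps the pieces inside the set on which the maps of the next
      -- generation are Lipschitz.
      refine ⟨Σ j, I (src j), inferInstance, fun p => X a ∩ φ a p.1 '' c (src p.1) p.2, ?_,
        fun p => inter_subset_left, ?_⟩
      · intro x hx
        obtain ⟨j, y, hy, rfl⟩ := mem_iUnion.1 (hcov a hx)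
        obtain ⟨i, hi⟩ := mem_iUnion.1 (hc (src j) hy)
        exact mem_iUnion.2 ⟨⟨j, i⟩, hx, y, hi, rfl⟩
      · rw [ENNReal.tsum_sigma' fun p : Σ j, I (src j) =>
          Metric.ediam (X a ∩ φ a p.1 '' c (src p.1) p.2) ^ (t : ℝ)]
        calc ∑' j, ∑' i, Metric.ediam (X a ∩ φ a j '' c (src j) i) ^ (t : ℝ)
            ≤ ∑' j, ∑' i, (lam j : ENNReal) ^ (t : ℝ) * Metric.ediam (c (src j) i) ^ (t : ℝ) := by
              refine ENNReal.tsum_le_tsum fun j => ENNReal.tsum_le_tsum fun i => ?_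
              rw [← ENNReal.mul_rpow_of_nonneg _ _ ht0.le]
              refine ENNReal.rpow_le_rpow ?_ ht0.le
              exact (Metric.ediam_mono inter_subset_right).trans
                (by simpa using ((hlip a j).mono (hcX _ i)).holderOnWith.ediam_image_le)
          _ ≤ ∑' j, (lam j : ENNReal) ^ (t : ℝ) * (D ^ (t : ℝ) * 2⁻¹ ^ n) := by
              refine ENNReal.tsum_le_tsum fun j => ?_
              rw [ENNReal.tsum_mul_left]
              exact mul_le_mul' le_rfl (hcs (src j))
          _ ≤ 2⁻¹ * (D ^ (t : ℝ) * 2⁻¹ ^ n) := by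
              rw [ENNReal.tsum_mul_right]
              exact mul_le_mul' hsum le_rfl
          _ = _ := by rw [pow_succ]; ring
  choose I hI c hc hcX hcs using fun n => key n a
  have hzero : Tendsto (fun n : ℕ => D ^ (t : ℝ) * (2⁻¹ : ENNReal) ^ n) atTop (𝓝 0) := by
    have := ENNReal.Tendsto.const_mul (a := D ^ (t : ℝ))
      (ENNReal.tendsto_pow_atTop_nhds_zero_of_lt_one (r := (2⁻¹ : ENNReal)) (by simp))
      (Or.inr (ENNReal.rpow_ne_top_of_nonneg ht0.le hD))
    simpa using this
  have hr : Tendsto (fun n : ℕ => (D ^ (t : ℝ) * (2⁻¹ : ENNReal) ^ n) ^ ((t : ℝ)⁻¹)) atTop (𝓝 0) := by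
    have := (ENNReal.continuous_rpow_const (y := (t : ℝ)⁻¹)).tendsto 0
    rw [ENNReal.zero_rpow_of_pos (inv_pos.2 ht0)] at this
    exact this.comp hzero
  have hmeas : Measure.hausdorffMeasure (t : ℝ) (X a) ≤ 0 := by
    refine (Measure.hausdorffMeasure_le_liminf_tsum (t : ℝ) (X a) _ hr c
      (Eventually.of_forall fun n i => ?_) (Eventually.of_forall hc)).trans ?_
    · rw [ENNReal.le_rpow_inv_iff ht0]
      exact (ENNReal.le_tsum i).trans (hcs n)
    · calc liminf (fun n => ∑' i, Metric.ediam (c n i) ^ (t : ℝ)) atTop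
          ≤ liminf (fun n : ℕ => D ^ (t : ℝ) * (2⁻¹ : ENNReal) ^ n) atTop :=
            liminf_le_liminf (Eventually.of_forall hcs)
        _ = 0 := hzero.liminf_eq
  exact dimH_le_of_hausdorffMeasure_ne_top (by rw [le_zero_iff.1 hmeas]; exact ENNReal.zero_ne_top)

variable {f : ℂ → ℂ} {R : ℝ}

/-- The points whose orbit is defined and stays in `{|z| > S}`. -/
def stayingSet (f : ℂ → ℂ) (S : ℝ) : Set ℂ := {z | OrbitDefined f z ∧ ∀ n, S < ‖f^[n] z‖}

theorem apply_mem_stayingSet {S : ℝ} {z : ℂ} (hz : z ∈ stayingSet f S) : f z ∈ stayingSet f S :=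
  ⟨fun n => hz.1 (n + 1), fun n => hz.2 (n + 1)⟩

theorem exists_bound_poleMultiplicity {M : ℕ}
    (hpoles : {z : ℂ | IsPole f z ∧ M < poleMultiplicity f z}.Finite) :
    ∃ M', ∀ a, IsPole f a → poleMultiplicity f a ≤ M' := by
  obtain ⟨B, hB⟩ := (hpoles.image (poleMultiplicity f)).bddAbove
  refine ⟨max M B, fun a ha => ?_⟩
  by_cases h : M < poleMultiplicity f a
  · exact (hB ⟨a, ⟨ha, h⟩, rfl⟩).trans (le_max_right _ _)
  · exact (not_lt.1 h).trans (le_max_left _ _)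

/-- A single threshold `4^M' R` on the modulus of the image forces the coordinate into the quarter
disc for all multiplicities up to `M'`. -/
theorem lt_quarter_tractRadius (hR : 0 < R) {m M' : ℕ} (hm : 0 < m) (hmM : m ≤ M') {v : ℂ}
    (hv0 : v ≠ 0) (hv : 4 ^ M' * R < ‖(v ^ m)⁻¹‖) : ‖v‖ < tractRadius R m / 4 := by
  have h1 : ‖v‖ * 4 < tractRadius R m := by
    rw [lt_tractRadius_iff hR hm (by positivity), mul_pow]
    have h4 : (4 : ℝ) ^ m ≤ 4 ^ M' := pow_le_pow_right₀ (by norm_num) hmM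
    have hvm : 0 < ‖v‖ ^ m := by positivity
    have h2 : 4 ^ m * R < (‖v‖ ^ m)⁻¹ := by
      rw [norm_inv, norm_pow] at hv
      exact lt_of_le_of_lt (mul_le_mul_of_nonneg_right h4 hR.le) hv
    have h3 := (lt_inv_comm₀ (by positivity) hvm).1 h2
    rw [mul_inv] at h3
    calc ‖v‖ ^ m * 4 ^ m < ((4 ^ m)⁻¹ * R⁻¹) * 4 ^ m := by gcongr
      _ = R⁻¹ := by field_simp
  linarith

/-- Outside a large disc, points of `highSet f R` with large image lie in the small parts of
tracts at large poles. -/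
theorem RegularAbove.exists_large_tract (h : RegularAbove f R) {T : ℂ → ℂ → ℂ}
    (hT : ∀ a, IsPole f a → IsTractMap f R a (T a)) {M : ℕ}
    (hpoles : {z : ℂ | IsPole f z ∧ M < poleMultiplicity f z}.Finite) (N : ℝ) :
    ∃ S : ℝ, ∀ z, ¬ IsPole f z → S < ‖z‖ → S < ‖f z‖ →
      ∃ a, IsPole f a ∧ N ≤ ‖a‖ ∧ ∃ u, u ≠ 0 ∧ u ∈ Metric.ball (0 : ℂ)
        (tractRadius R (poleMultiplicity f a) / 4) ∧ T a u = z := by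
  have hR : 0 < R := zero_lt_one.trans_le h.one_le
  obtain ⟨M', hM'⟩ := exists_bound_poleMultiplicity hpoles
  -- The distortion bounds exclude a pole at `0`. Its quarter tract is bounded, so it is avoided by
  -- taking `S` large.
  obtain ⟨B, hB⟩ : ∃ B : ℝ, IsPole f 0 → ∀ u ∈ Metric.ball (0 : ℂ)
      (tractRadius R (poleMultiplicity f 0) / 4), ‖T 0 u‖ ≤ B := by
    by_cases h0 : IsPole f 0
    · have hr := tractRadius_pos hR (poleMultiplicity f 0)
      have hc : ContinuousOn (T 0) (Metric.closedBall 0 (tractRadius R (poleMultiplicity f 0) / 4)) :=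
        (hT 0 h0).differentiableOn.continuousOn.mono
          (Metric.closedBall_subset_ball (by linarith))
      obtain ⟨B, hB⟩ := (isCompact_closedBall _ _).exists_bound_of_continuousOn hc
      exact ⟨B, fun _ u hu => hB u (Metric.ball_subset_closedBall hu)⟩
    · exact ⟨0, fun h => absurd h h0⟩
  refine ⟨max (max (4 ^ M' * R) R) (max B (Real.exp 8000 * N)), fun z hz hzS hfS => ?_⟩
  simp only [max_lt_iff] at hzS hfS
  obtain ⟨a, ha, u, hu0, hu, rfl⟩ := h.exists_mem_tract hT ⟨hz, hfS.1.2⟩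
  have hm := (hT a ha).poleMultiplicity_pos h
  have hval := (hT a ha).apply_eq u (mem_ball_zero_iff.2 hu) hu0
  have huq : ‖u‖ < tractRadius R (poleMultiplicity f a) / 4 :=
    lt_quarter_tractRadius hR hm (hM' a ha) hu0 (hval ▸ hfS.1.1)
  have huq' := mem_ball_zero_iff.2 huq
  have ha0 : a ≠ 0 := by
    rintro rfl
    exact absurd (hB ha u huq') (not_le.2 hzS.2.1)
  refine ⟨a, ha, ?_, u, hu0, huq', rfl⟩
  have h1 := ((hT a ha).norm_mem_Icc h ha0 (mem_ball_zero_iff.2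
    (huq.trans (by linarith [tractRadius_pos hR (poleMultiplicity f a)])))).2
  exact le_of_mul_le_mul_left (hzS.2.2.le.trans h1) (Real.exp_pos _)

/-- The inverse branches of `f` in the coordinates given by the tract maps. -/
noncomputable def branchMap (L : ℂ → ℂ) (m : ℕ) (j : ℕ) (v : ℂ) : ℂ :=
  Complex.exp (-L v / m) * Complex.exp (2 * Real.pi * Complex.I / m) ^ j

theorem exists_eq_branchMap {L : ℂ → ℂ} {m : ℕ} (hm : 0 < m) {u v : ℂ}
    (huv : (u ^ m)⁻¹ = Complex.exp (L v)) : ∃ j < m, u = branchMap L m j v := by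
  have hm0 : (m : ℂ) ≠ 0 := Nat.cast_ne_zero.2 hm.ne'
  have : NeZero m := ⟨hm.ne'⟩
  have h1 : (u / Complex.exp (-L v / m)) ^ m = 1 := by
    rw [div_pow, ← Complex.exp_nat_mul, mul_div_cancel₀ _ hm0, Complex.exp_neg, ← huv, inv_inv]
    refine div_self fun h0 => ?_
    rw [h0, inv_zero] at huv
    exact Complex.exp_ne_zero _ huv.symm
  obtain ⟨j, hj, hj'⟩ := (Complex.isPrimitiveRoot_exp m hm.ne').eq_pow_of_pow_eq_one h1
  refine ⟨j, hj, ?_⟩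
  rw [branchMap, hj', mul_div_cancel₀ _ (Complex.exp_ne_zero _)]

/-- The derivative has modulus `|exp L|^(-1/m) |L'| / m`. Since `|exp L| ≥ 1`, the exponent `-1/m`
may be replaced by `-1/M`, so the constant does not depend on the target tract. -/
theorem lipschitzOnWith_branchMap {L L' : ℂ → ℂ} {s : Set ℂ} (hs : Convex ℝ s) {m M j : ℕ} (hm : 0 < m)
    (hmM : m ≤ M) {β A : ℝ} (hA : 0 < A)
    (hL : ∀ v ∈ s, HasDerivAt L (L' v) v) (hβ : ∀ v ∈ s, ‖L' v‖ ≤ β)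
    (h1 : ∀ v ∈ s, 1 ≤ ‖Complex.exp (L v)‖) (hAL : ∀ v ∈ s, A ≤ ‖Complex.exp (L v)‖)
    {C : NNReal} (hC : A ^ (-(1 / (M : ℝ))) * β ≤ C) :
    LipschitzOnWith C (branchMap L m j) s := by
  have hm1 : (1 : ℝ) ≤ m := by exact_mod_cast hm
  have hder : ∀ v ∈ s, HasDerivAt (branchMap L m j)
      (Complex.exp (-L v / m) * (-L' v / m) * Complex.exp (2 * Real.pi * Complex.I / m) ^ j) v :=
    fun v hv => (((hL v hv).neg.div_const (m : ℂ)).cexp).mul_const _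
  refine hs.lipschitzOnWith_of_nnnorm_hasDerivWithin_le
    (fun v hv => (hder v hv).hasDerivWithinAt) fun v hv => ?_
  have hroot : ‖Complex.exp (2 * Real.pi * Complex.I / m)‖ = 1 :=
    (Complex.isPrimitiveRoot_exp m hm.ne').norm'_eq_one hm.ne'
  have hexp : ‖Complex.exp (-L v / m)‖ = ‖Complex.exp (L v)‖ ^ (-(1 / (m : ℝ))) := by
    rw [Complex.norm_exp, Complex.norm_exp, ← Real.exp_mul]
    congr 1
    have : (-L v / m : ℂ) = ((-(1 / (m : ℝ)) : ℝ) : ℂ) * L v := by push_cast; ring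
    rw [this, Complex.re_ofReal_mul, mul_comm]
  have hbound : ‖Complex.exp (L v)‖ ^ (-(1 / (m : ℝ))) ≤ A ^ (-(1 / (M : ℝ))) := by
    refine le_trans (Real.rpow_le_rpow_of_exponent_le (h1 v hv) (neg_le_neg
      (one_div_le_one_div_of_le (by positivity) (show (m : ℝ) ≤ M by exact_mod_cast hmM)))) ?_
    exact Real.rpow_le_rpow_of_nonpos hA (hAL v hv) (by simp)
  rw [← NNReal.coe_le_coe, coe_nnnorm, norm_mul, norm_mul, norm_pow, hroot, one_pow, mul_one, hexp,
    norm_div, norm_neg, Complex.norm_natCast]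
  refine le_trans ?_ hC
  refine mul_le_mul hbound ?_ (by positivity) (by positivity)
  exact (div_le_self (norm_nonneg _) hm1).trans (hβ v hv)

theorem exists_tail_tsum_le {g : ℂ → ENNReal} {Q : ℂ → Prop}
    (hg : ∑' a : {a // Q a}, g a ≠ ⊤) {η : ENNReal} (hη : 0 < η) :
    ∃ N₀ : ℝ, ∀ N, N₀ ≤ N → ∑' a : {a // Q a ∧ N ≤ ‖a‖}, g a ≤ η := by
  have htail := (ENNReal.tendsto_tsum_compl_atTop_zero hg).eventually (ge_mem_nhds hη)
  obtain ⟨F, hF⟩ := htail.exists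
  obtain ⟨B, hB⟩ := (F.finite_toSet.image fun a : {a // Q a} => ‖(a : ℂ)‖).bddAbove
  refine ⟨B + 1, fun N hN => le_trans ?_ hF⟩
  let i : {a // Q a ∧ N ≤ ‖a‖} → {x : {a // Q a} // x ∉ F} := fun a =>
    ⟨⟨a, a.2.1⟩, fun ha => by
      have := hB ⟨_, ha, rfl⟩
      have h2 := a.2.2
      simp only at this
      linarith⟩
  have hi : Function.Injective i := fun a b hab =>
    Subtype.ext (congrArg (fun x : {x : {a // Q a} // x ∉ F} => ((x : {a // Q a}) : ℂ)) hab)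
  exact ENNReal.tsum_comp_le_tsum_of_injective hi (fun x : {x : {a // Q a} // x ∉ F} => g x)

end MeroDyn

/-! ### Dimension of the set of orbits that stay far out. -/

namespace MeroDyn
open MeasureTheory
variable {f : ℂ → ℂ} {R : ℝ}

/-- In tract coordinates the staying points at poles of modulus at least `N` form a graph-directed
system: a branch is indexed by the next pole `b` and an `m`-th root of unity, hence at most `M`
branches for each `b`. The contraction sum is a tail of a convergent series. -/
theorem RegularAbove.exists_dimH_stayingSet_le (h : RegularAbove f R) {ρ : ℝ}
    (hρ : order f = (ρ : EReal)) (hρ0 : 0 ≤ ρ) {M : ℕ} (hM : 1 ≤ M)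
    (hpoles : {z : ℂ | IsPole f z ∧ M < poleMultiplicity f z}.Finite) {t : NNReal}
    (ht : 2 * M * ρ / (2 + M * ρ) < t) (ht2 : (t : ℝ) < 2) :
    ∃ S : ℝ, dimH (stayingSet f S) ≤ t := by
  have hR : 0 < R := zero_lt_one.trans_le h.one_le
  have ht0 : (0 : ℝ) < t := lt_of_le_of_lt (by positivity) ht
  have hex : ∀ a, IsPole f a → ∃ G, IsTractMap f R a G := fun a ha => h.exists_isTractMap ha
  choose! T hT using hex
  obtain ⟨β, hβ, hβsum⟩ := h.exists_deriv_bounds hT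
  have hsum := tsum_contraction_ne_top h.nf hρ hρ0 hM ht ht2
    (P := {a | IsPole f a ∧ Real.exp 8000 ≤ ‖a‖}) (β := β)
    (fun a ha => ⟨ha.1, (Real.one_le_exp (by norm_num)).trans ha.2⟩)
    (fun a ha => (hβ a ha.1 (norm_pos_iff.1 ((Real.exp_pos _).trans_le ha.2))).1) hβsum
  set c : ℝ := Real.exp (8000 * (1 / (M : ℝ))) with hc
  have hc0 : 0 < c := Real.exp_pos _
  -- `κ` collects the `M` roots of unity and the distortion factor `c^t`; a tail at most `1/(2κ)`
  -- makes the contraction sum at most `1/2`.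
  set κ : ENNReal := M * ENNReal.ofReal (c ^ (t : ℝ)) with hκ
  have hκtop : κ ≠ ⊤ := ENNReal.mul_ne_top (ENNReal.natCast_ne_top M) ENNReal.ofReal_ne_top
  obtain ⟨N₀, hN₀⟩ := exists_tail_tsum_le
    (g := fun a => ENNReal.ofReal ((‖a‖ ^ (-(1 / (M : ℝ))) * β a) ^ (t : ℝ)))
    (Q := fun a => IsPole f a ∧ Real.exp 8000 ≤ ‖a‖) hsum
    (η := 2⁻¹ / κ) (ENNReal.div_pos (by simp) hκtop)
  obtain ⟨B, hB⟩ := (hpoles.image fun a => ‖a‖).bddAbove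
  -- Beyond `N` the tail is small, no pole has multiplicity above `M`, and the distortion bounds
  -- give modulus at least `1`.
  set N : ℝ := max (max N₀ (B + 1)) (Real.exp 8000) with hN
  obtain ⟨S, hS⟩ := h.exists_large_tract hT hpoles N
  set ι := {a : ℂ // (IsPole f a ∧ Real.exp 8000 ≤ ‖a‖) ∧ N ≤ ‖a‖} with hι
  have hmult : ∀ a : ι, poleMultiplicity f a ≤ M := fun a => by
    by_contra hcon
    have h1 : ‖(a : ℂ)‖ ≤ B := hB ⟨a, ⟨a.2.1.1, not_le.1 hcon⟩, rfl⟩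
    have h2 : B + 1 ≤ ‖(a : ℂ)‖ := ((le_max_right _ _).trans (le_max_left _ _)).trans a.2.2
    linarith
  have hne : ∀ a : ι, (a : ℂ) ≠ 0 := fun a => norm_pos_iff.1 ((Real.exp_pos _).trans_le a.2.1.2)
  have hcount : Countable ι :=
    ((countable_setOf_isPole h.nf).mono (fun a (ha : (IsPole f a ∧ _) ∧ _) => ha.1.1)).to_subtype
  have hr : ∀ a : ℂ, 0 < tractRadius R (poleMultiplicity f a) := fun a => tractRadius_pos hR _
  have hlog : ∀ a : ι, ∃ L : ℂ → ℂ, ∀ u ∈ Metric.ball (0 : ℂ) (tractRadius R (poleMultiplicity f a)),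
      HasDerivAt L (deriv (T a) u / T a u) u ∧ Complex.exp (L u) = T a u := fun a =>
    exists_log_branch (hr a) (hT a a.2.1.1).differentiableOn fun u hu =>
      (hT a a.2.1.1).ne_zero h (hne a) hu
  choose L hL using hlog
  have hqsub : ∀ a : ι, Metric.ball (0 : ℂ) (tractRadius R (poleMultiplicity f a) / 4) ⊆
      Metric.ball 0 (tractRadius R (poleMultiplicity f a)) := fun a =>
    Metric.ball_subset_ball (by linarith [hr a])
  have hqsub' : ∀ a : ι, Metric.ball (0 : ℂ) (tractRadius R (poleMultiplicity f a) / 4) ⊆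
      Metric.ball 0 (tractRadius R (poleMultiplicity f a) / 2) := fun a =>
    Metric.ball_subset_ball (by linarith [hr a])
  set X : ι → Set ℂ := fun a => {u | u ∈ Metric.ball (0 : ℂ) (tractRadius R (poleMultiplicity f a) / 4) ∧
    u ≠ 0 ∧ T a u ∈ stayingSet f S} with hX
  have hXdim : ∀ a, dimH (X a) ≤ t := by
    refine dimH_le_of_contractions (J := ι × Fin M) Prod.fst X
      (fun a p => branchMap (L p.1) (poleMultiplicity f a) p.2)
      (fun p => Real.toNNReal (c * (‖(p.1 : ℂ)‖ ^ (-(1 / (M : ℝ))) * β p.1)))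
      (D := Metric.ediam (Metric.ball (0 : ℂ) 1)) Metric.isBounded_ball.ediam_ne_top ?_ ?_ ?_
      (by exact_mod_cast ht0) ?_
    · intro a
      refine Metric.ediam_mono fun u hu => ?_
      refine Metric.ball_subset_ball ?_ hu.1
      have : tractRadius R (poleMultiplicity f a) ≤ 1 :=
        Real.rpow_le_one_of_one_le_of_nonpos h.one_le (by simp)
      linarith
    · rintro a u ⟨hu, hu0, huK⟩
      have hw := apply_mem_stayingSet huK
      -- The image point again has a large image, so it too lies in the quarter tract of a large
      -- pole.
      obtain ⟨b, hb, hbN, v, hv0, hv, hvw⟩ := hS (f (T a u)) (hw.1 0) (hw.2 0) (hw.2 1)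
      let b' : ι := ⟨b, ⟨hb, (le_max_right _ _).trans hbN⟩, hbN⟩
      have hval := (hT a a.2.1.1).apply_eq u (hqsub a hu) hu0
      obtain ⟨j, hj, hju⟩ := exists_eq_branchMap ((hT a a.2.1.1).poleMultiplicity_pos h)
        (L := L b') (u := u) (v := v) (by
          rw [← hval, (hL b' v (hqsub b' hv)).2, ← hvw])
      exact mem_iUnion.2 ⟨(b', ⟨j, hj.trans_le (hmult a)⟩), v, ⟨hv, hv0, by rw [hvw]; exact hw⟩,
        hju.symm⟩
    · rintro a ⟨b, j⟩
      have hb0 : 0 < ‖(b : ℂ)‖ := norm_pos_iff.2 (hne b)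
      have hA1 : 1 ≤ Real.exp (-8000) * ‖(b : ℂ)‖ := by
        rw [Real.exp_neg, ← div_eq_inv_mul, one_le_div (Real.exp_pos _)]
        exact b.2.1.2
      have hAL : ∀ v ∈ Metric.ball (0 : ℂ) (tractRadius R (poleMultiplicity f b) / 4),
          Real.exp (-8000) * ‖(b : ℂ)‖ ≤ ‖Complex.exp (L b v)‖ := fun v hv => by
        rw [(hL b v (hqsub b hv)).2]
        exact ((hT b b.2.1.1).norm_mem_Icc h (hne b) (hqsub' b hv)).1
      refine (lipschitzOnWith_branchMap (M := M) (A := Real.exp (-8000) * ‖(b : ℂ)‖) (β := β b)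
        (convex_ball (0 : ℂ) (tractRadius R (poleMultiplicity f b) / 4))
        ((hT a a.2.1.1).poleMultiplicity_pos h) (hmult a) (by positivity)
        (fun v hv => (hL b v (hqsub b hv)).1) (hβ b b.2.1.1 (hne b)).2
        (fun v hv => hA1.trans (hAL v hv)) hAL ?_).mono fun u hu => hu.1
      have hβ0 := (hβ b b.2.1.1 (hne b)).1
      rw [Real.coe_toNNReal _ (by positivity), Real.mul_rpow (Real.exp_pos _).le hb0.le,
        ← Real.exp_mul, mul_assoc]
      have : (-8000 : ℝ) * -(1 / (M : ℝ)) = 8000 * (1 / (M : ℝ)) := by ring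
      rw [this]
    · rw [ENNReal.tsum_prod' ]
      have hterm : ∀ b : ι, ∑' _ : Fin M, ((Real.toNNReal
          (c * (‖(b : ℂ)‖ ^ (-(1 / (M : ℝ))) * β b)) : NNReal) : ENNReal) ^ (t : ℝ) =
          κ * ENNReal.ofReal ((‖(b : ℂ)‖ ^ (-(1 / (M : ℝ))) * β b) ^ (t : ℝ)) := by
        intro b
        have hβ0 := (hβ b b.2.1.1 (hne b)).1
        have h1 : ((Real.toNNReal (c * (‖(b : ℂ)‖ ^ (-(1 / (M : ℝ))) * β b)) : NNReal) : ENNReal) =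
          ENNReal.ofReal (c * (‖(b : ℂ)‖ ^ (-(1 / (M : ℝ))) * β b)) := rfl
        rw [h1, ENNReal.ofReal_rpow_of_nonneg (by positivity) ht0.le,
          Real.mul_rpow hc0.le (by positivity), ENNReal.ofReal_mul (by positivity), tsum_fintype,
          Finset.sum_const, Finset.card_univ, Fintype.card_fin, nsmul_eq_mul, ← mul_assoc]
      rw [tsum_congr hterm, ENNReal.tsum_mul_left]
      have h2 := hN₀ N ((le_max_left _ _).trans (le_max_left _ _))
      exact (mul_le_mul' le_rfl h2).trans ENNReal.mul_div_le
  refine ⟨S, ?_⟩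
  have hcover : stayingSet f S ⊆ ⋃ a : ι, T a '' X a := by
    intro z hz
    obtain ⟨a, ha, haN, u, hu0, hu, rfl⟩ := hS z (hz.1 0) (hz.2 0) (hz.2 1)
    exact mem_iUnion.2 ⟨⟨a, ⟨ha, (le_max_right _ _).trans haN⟩, haN⟩, u, ⟨hu, hu0, hz⟩, rfl⟩
  refine (dimH_mono hcover).trans ?_
  rw [dimH_iUnion]
  refine iSup_le fun a => le_trans ?_ (hXdim a)
  have hdiff : ContDiffOn ℝ 1 (T a) (Metric.ball 0 (tractRadius R (poleMultiplicity f a))) :=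
    ((hT a a.2.1.1).differentiableOn.contDiffOn Metric.isOpen_ball).restrict_scalars ℝ
  exact hdiff.dimH_image_le (convex_ball _ _) fun u hu => hqsub a hu.1

/-! ### Preimages and passage to the escaping sets. -/

theorem stayingSet_eq_empty (h : RegularAbove f R) (hno : ∀ a, ¬ IsPole f a) :
    stayingSet f R = ∅ := by
  rw [eq_empty_iff_forall_notMem]
  intro z hz
  obtain ⟨a, ha, -⟩ := h.exists_mem_tract (T := fun _ => id) (fun a ha => absurd ha (hno a))
    (show z ∈ highSet f R from ⟨hz.1 0, hz.2 1⟩)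
  exact hno a ha

/-- Zeros of `deriv f` are isolated, for otherwise `f` would be constant on a disc, against the
discreteness of its fibres. A discrete subset of the plane is countable. -/
theorem countable_setOf_deriv_eq_zero (hf : MeromorphicNFOn f univ) (hnc : ∀ c : ℂ, ∃ z, f z ≠ c) :
    {z | ¬ IsPole f z ∧ deriv f z = 0}.Countable := by
  obtain ⟨t, -, htc, hst⟩ := TopologicalSpace.countable_cover_nhdsWithin
    (f := fun x : ℂ => {x}) (s := {z | ¬ IsPole f z ∧ deriv f z = 0}) (by
    rintro x ⟨hx, -⟩
    have han := analyticAt_of_not_isPole hf hx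
    rcases han.deriv.eventually_eq_zero_or_eventually_ne_zero with h0 | h0
    · exfalso
      obtain ⟨δ, hδ, hball⟩ := Metric.eventually_nhds_iff_ball.1 (h0.and han.eventually_analyticAt)
      have hconst : ∀ y ∈ Metric.ball x δ, f y = f x := fun y hy =>
        (convex_ball x δ).is_const_of_fderivWithin_eq_zero (𝕜 := ℂ)
          (fun z hz => (hball z hz).2.differentiableAt.differentiableWithinAt)
          (fun z hz => by
            rw [fderivWithin_of_isOpen Metric.isOpen_ball hz]
            ext; simp [(hball z hz).1]) hy (Metric.mem_ball_self hδ)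
      have h1 := eventually_toSphere_ne hf hnc (f x : OnePoint ℂ) x
      have h2 : ∀ᶠ z in 𝓝[≠] x, z ∈ Metric.ball x δ :=
        eventually_nhdsWithin_of_eventually_nhds (Metric.ball_mem_nhds x hδ)
      obtain ⟨z, h1, h2, h3⟩ := (h1.and (h2.and (eventually_not_isPole hf x))).exists
      exact h1 (toSphere_eq_coe_iff.2 ⟨h3, hconst z h2⟩)
    · rw [mem_nhdsWithin_iff_eventually]
      filter_upwards [eventually_nhdsWithin_iff.1 h0] with z hz hzs
      by_contra hne
      exact hz hne hzs.2)
  exact htc.mono fun x hx => by simpa using hst hx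

/-- Critical points are countable and so have dimension zero. Near any other point the preimage is a
Lipschitz image, under a local inverse, of part of `A`; dimension is decided locally. -/
theorem dimH_preimage_le (hf : MeromorphicNFOn f univ) (hnc : ∀ c : ℂ, ∃ z, f z ≠ c) (A : Set ℂ) :
    dimH {z | ¬ IsPole f z ∧ f z ∈ A} ≤ dimH A := by
  set E : Set ℂ := {z | (¬ IsPole f z ∧ deriv f z ≠ 0) ∧ f z ∈ A} with hE
  have hsub : {z | ¬ IsPole f z ∧ f z ∈ A} ⊆ {z | ¬ IsPole f z ∧ deriv f z = 0} ∪ E := by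
    rintro z ⟨h1, h2⟩
    by_cases h0 : deriv f z = 0
    · exact Or.inl ⟨h1, h0⟩
    · exact Or.inr ⟨⟨h1, h0⟩, h2⟩
  refine (dimH_mono hsub).trans ?_
  rw [dimH_union, (countable_setOf_deriv_eq_zero hf hnc).dimH_zero]
  refine max_le zero_le ?_
  by_contra hlt
  obtain ⟨x, hx, hxt⟩ := exists_mem_nhdsWithin_lt_dimH_of_lt_dimH (not_le.1 hlt)
  have hs := ((analyticAt_of_not_isPole hf hx.1.1).hasStrictDerivAt).hasStrictFDerivAt_equiv hx.1.2
  obtain ⟨K, s, hs', hK⟩ := hs.to_localInverse.exists_lipschitzOnWith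
  set L := hs.localInverse f _ x
  have hev : ∀ᶠ z in 𝓝 x, L (f z) = z ∧ f z ∈ s :=
    hs.eventually_left_inverse.and (hs.continuousAt.eventually hs')
  have h1 := hxt (E ∩ {z | L (f z) = z ∧ f z ∈ s})
    (inter_mem self_mem_nhdsWithin (mem_nhdsWithin_of_mem_nhds hev))
  refine absurd h1 (not_lt.2 ?_)
  calc dimH (E ∩ {z | L (f z) = z ∧ f z ∈ s}) ≤ dimH (L '' (A ∩ s)) := by
        refine dimH_mono ?_
        rintro z ⟨hz, hz1, hz2⟩
        exact ⟨f z, ⟨hz.2, hz2⟩, hz1⟩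
    _ ≤ dimH (A ∩ s) := (hK.mono inter_subset_right).dimH_image_le
    _ ≤ dimH A := dimH_mono inter_subset_left

theorem dimH_iterate_preimage_le (hf : MeromorphicNFOn f univ) (hnc : ∀ c : ℂ, ∃ z, f z ≠ c)
    (A : Set ℂ) (n : ℕ) : dimH {z | OrbitDefined f z ∧ f^[n] z ∈ A} ≤ dimH A := by
  induction n with
  | zero => exact dimH_mono fun z hz => hz.2
  | succ n ih =>
    refine le_trans ?_ ((dimH_preimage_le hf hnc {z | OrbitDefined f z ∧ f^[n] z ∈ A}).trans ih)
    refine dimH_mono fun z hz => ⟨hz.1 0, fun k => hz.1 (k + 1), hz.2⟩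

/-- A lower limit of at least `S' > S` puts some iterate into `stayingSet f S`, so countably many
iterated preimages of that set cover everything. -/
theorem dimH_escapingSetAbove_le (hf : MeromorphicNFOn f univ) (hnc : ∀ c : ℂ, ∃ z, f z ≠ c)
    {S S' : ℝ} (hSS' : S < S') (hS' : 0 < S') :
    dimH (escapingSetAbove f S') ≤ dimH (stayingSet f S) := by
  have hsub : escapingSetAbove f S' ⊆ ⋃ n : ℕ, {z | OrbitDefined f z ∧ f^[n] z ∈ stayingSet f S} := by
    rintro z ⟨hz, hlim⟩
    have h1 : ENNReal.ofReal S < liminf (fun n : ℕ => ‖f^[n] z‖ₑ) atTop :=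
      ((ENNReal.ofReal_lt_ofReal_iff hS').2 hSS').trans_le hlim
    obtain ⟨n, hn⟩ := eventually_atTop.1 (eventually_lt_of_lt_liminf h1)
    refine mem_iUnion.2 ⟨n, hz, fun k => ?_, fun k => ?_⟩
    · rw [← Function.iterate_add_apply]; exact hz _
    · rw [← Function.iterate_add_apply]
      have := hn (k + n) (Nat.le_add_left _ _)
      rw [← ofReal_norm] at this
      exact lt_of_not_ge fun hle => absurd (ENNReal.ofReal_le_ofReal hle) (not_le.2 this)
  refine (dimH_mono hsub).trans ?_
  rw [dimH_iUnion]
  exact iSup_le fun n => dimH_iterate_preimage_le hf hnc _ n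

theorem antitone_escapingSetAbove : Antitone (escapingSetAbove f) := fun _ _ hS _ hz =>
  ⟨hz.1, (ENNReal.ofReal_le_ofReal hS).trans hz.2⟩

theorem escapingSet_subset (S : ℝ) : escapingSet f ⊆ escapingSetAbove f S := by
  rintro z ⟨hz, hlim⟩
  refine ⟨hz, le_liminf_of_le (by isBoundedDefault) ?_⟩
  filter_upwards [(tendsto_norm_atTop_iff_cobounded.2 hlim).eventually_ge_atTop S] with n hn
  rw [← ofReal_norm]
  exact ENNReal.ofReal_le_ofReal hn

theorem exists_regularAbove (hf : MeromorphicNFOn f univ) (htrans : IsTranscendental f)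
    (hB : ClassB f) (hinf : ¬ IsAsymptoticValue f OnePoint.infty) : ∃ R, RegularAbove f R := by
  obtain ⟨C, hC⟩ := hB.exists_norm_le
  refine ⟨max 1 (max ‖f 0‖ C), hf, fun c => ?_, le_max_left _ _,
    (le_max_left _ _).trans (le_max_right _ _),
    fun v hv => (hC v hv).trans ((le_max_right _ _).trans (le_max_right _ _)), hinf⟩
  by_contra hcon
  push Not at hcon
  exact htrans ⟨Polynomial.C c, 1, one_ne_zero, fun z _ => by simp [hcon z]⟩

theorem exists_dimH_escapingSetAbove_le (h : RegularAbove f R) {ρ : ℝ}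
    (hρ : order f = (ρ : EReal)) {M : ℕ} (hM : 1 ≤ M)
    (hpoles : {z : ℂ | IsPole f z ∧ M < poleMultiplicity f z}.Finite) {d : ENNReal}
    (hd : ENNReal.ofReal (2 * M * ρ / (2 + M * ρ)) < d) :
    ∃ S : ℝ, dimH (escapingSetAbove f S) ≤ d := by
  by_cases hno : ∀ a, ¬ IsPole f a
  · refine ⟨R + 1, (dimH_escapingSetAbove_le h.nf h.nonconst (lt_add_one R)
      (by linarith [h.one_le])).trans ?_⟩
    rw [stayingSet_eq_empty h hno, dimH_empty]
    exact zero_le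
  · push Not at hno
    obtain ⟨a, ha⟩ := hno
    have hρ0 := order_nonneg_of_isPole h.nf hρ ha
    have hM0 : (0 : ℝ) < M := by exact_mod_cast hM
    have hlt2 : 2 * M * ρ / (2 + M * ρ) < 2 := by
      rw [div_lt_iff₀ (by positivity)]; linarith
    -- The critical exponent is always below `2`. Choosing `t < 2` as well keeps the weight `1 -
    -- t/2` positive.
    have hlt : ENNReal.ofReal (2 * M * ρ / (2 + M * ρ)) < min d 2 := by
      refine lt_min hd ?_
      rw [← ENNReal.ofReal_ofNat]
      exact (ENNReal.ofReal_lt_ofReal_iff two_pos).2 hlt2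
    obtain ⟨t, ht1, ht2⟩ := ENNReal.lt_iff_exists_nnreal_btwn.1 hlt
    rw [lt_min_iff] at ht2
    obtain ⟨S, hS⟩ := h.exists_dimH_stayingSet_le hρ hρ0 hM hpoles (t := t)
      ((ENNReal.ofReal_lt_coe_iff (by positivity)).1 ht1) (by exact_mod_cast ht2.2)
    refine ⟨max (S + 1) 1, (dimH_escapingSetAbove_le h.nf h.nonconst
      (lt_max_of_lt_left (lt_add_one S)) (lt_max_of_lt_right one_pos)).trans (hS.trans ht2.1.le)⟩

end MeroDyn

theorem theorem1 (f : ℂ → ℂ) (hf : MeromorphicNFOn f Set.univ)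
    (htrans : MeroDyn.IsTranscendental f) (hB : MeroDyn.ClassB f)
    (ρ : ℝ) (hρ : MeroDyn.order f = (ρ : EReal))
    (hinf : ¬ MeroDyn.IsAsymptoticValue f OnePoint.infty)
    (M : ℕ) (hM : 1 ≤ M)
    (hpoles : {z : ℂ | MeroDyn.IsPole f z ∧ M < MeroDyn.poleMultiplicity f z}.Finite) :
    dimH (MeroDyn.escapingSet f) ≤ ENNReal.ofReal (2 * M * ρ / (2 + M * ρ)) ∧
    ∃ L : ENNReal,
      Filter.Tendsto (fun R : ℝ => dimH (MeroDyn.escapingSetAbove f R)) Filter.atTop (nhds L) ∧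
      L ≤ ENNReal.ofReal (2 * M * ρ / (2 + M * ρ)) := by
  obtain ⟨R, h⟩ := MeroDyn.exists_regularAbove hf htrans hB hinf
  -- By monotonicity in `S` this infimum is the limit, and it bounds `dimH (escapingSet f)` as well.
  have hle : ⨅ S : ℝ, dimH (MeroDyn.escapingSetAbove f S) ≤
      ENNReal.ofReal (2 * M * ρ / (2 + M * ρ)) := by
    refine le_of_forall_gt_imp_ge_of_dense fun d hd => ?_
    obtain ⟨S, hS⟩ := MeroDyn.exists_dimH_escapingSetAbove_le h hρ hM hpoles hd
    exact (iInf_le _ S).trans hS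
  refine ⟨(le_iInf fun S => dimH_mono (MeroDyn.escapingSet_subset S)).trans hle, _,
    tendsto_atTop_iInf fun S S' hSS' => dimH_mono (MeroDyn.antitone_escapingSetAbove hSS'), hle⟩
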